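/- Let $A$ be a real $m\times n$ matrix of rank $r$, $m\le n$, with singular values $\sigma_1\ge\sigma_2\ge\dots\ge\sigma_r>0$ and $\sigma_k:=0$ for $k>r$. Let $1\le p\le r$ and assume $\delta_p:=\sigma_p-\sigma_{p+1}>0$. For a matrix $M$ with singular value decomposition $M=\sum_{i}\sigma_i(M)\,u_iv_i^\top$ ($\sigma_1(M)\ge\sigma_2(M)\ge\dots$), write $M_p:=\sum_{i\le p}\sigma_i(M)\,u_iv_i^\top$ for its best rank $p$ approximation, and let $\|\cdot\|$ be the spectral norm. Let $K,\sigma$ be real numbers and let $E=(\xi_{ij})$ be a $(K,\sigma)$-bounded random $m\times n$ real matrix: the entries $\xi_{ij}$ are independent random variables with mean $0$, almost surely $|\xi_{ij}|\le K$ for all $i,j$, and $\mathrm{Var}(\xi_{ij})\le\sigma^2$ for all $i,j$. Put $\tilde A=A+E$ and $$\epsilon_1=\frac{\|E\|}{\sigma_p},\qquad \epsilon_2=\frac1{\delta_p},\qquad \eta=\frac{\|E\|^2}{\sigma_p\delta_p}.$$ For $t_1>0$ let $\mathbf{C0}$ be the condition $$\max\left\{p\,\epsilon_1,\ r^2t_1\epsilon_2,\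 \sqrt{r\eta}\right\}\le\frac1{96}.$$ Then for every $t_1>0$ (with $2\sigma^2+Kt_1>0$, so that the probability below is well defined) there is an event of probability at least $$1-r^2\exp\left(\frac{-t_1^2/2}{2\sigma^2+Kt_1}\right)$$ on which, whenever $\mathbf{C0}$ holds (for the realized $E$), every choice of best rank $p$ approximation $\tilde A_p$ of $\tilde A$ of the above form satisfies $$\|\tilde A_p-A_p\|\le 32\,\sigma_p\left(\epsilon_1+r t_1\epsilon_2+\frac{r^2\|E\|^2}{\sigma_p\delta_p}\right)=32\left[\|E\|+\frac{r t_1\sigma_p}{\delta_p}+\frac{r^2\|E\|^2}{\delta_p}\right].$$ -/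

import Mathlib

open MeasureTheory ProbabilityTheory
open scoped Matrix.Norms.L2Operator

namespace LowRankPerturbation

noncomputable section

/-- The `k`-th largest singular value `σ_k` of a real matrix, for `k = 1, 2, 3, …`, counted with
multiplicity; it is `0` for `k` larger than the rank. (Mathlib numbers them from `0`.) -/
def sv {m n : ℕ} (A : Matrix (Fin m) (Fin n) ℝ) (k : ℕ) : ℝ :=
  (Matrix.toEuclideanLin A).singularValues (k - 1)

/-- The singular value gap `δ_k = σ_k - σ_{k+1}`. -/
def gap {m n : ℕ} (A : Matrix (Fin m) (Fin n) ℝ) (k : ℕ) : ℝ :=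
  sv A k - sv A (k + 1)

/-- `u`, `v` are systems of left and right singular vectors of `A`: they are orthonormal and
`A = ∑_{i=1}^{rank A} σ_i u_i v_iᵀ`, with `σ_1 ≥ σ_2 ≥ …` the singular values of `A`
(the index `i : Fin A.rank` stands for `i + 1`). -/
structure IsSVD {m n : ℕ} (A : Matrix (Fin m) (Fin n) ℝ)
    (u : Fin A.rank → EuclideanSpace ℝ (Fin m)) (v : Fin A.rank → EuclideanSpace ℝ (Fin n)) :
    Prop where
  orthonormal_left : Orthonormal ℝ u
  orthonormal_right : Orthonormal ℝ v
  decomposition :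
    A = ∑ i : Fin A.rank, sv A ((i : ℕ) + 1) • Matrix.vecMulVec (u i).ofLp (v i).ofLp

/-- `B` is a best rank `p` approximation of `A`, that is `B = ∑_{i=1}^{p} σ_i u_i v_iᵀ` for some
singular value decomposition of `A` (terms with `i > rank A` have `σ_i = 0` and are absent). -/
def IsBestRankApprox {m n : ℕ} (A : Matrix (Fin m) (Fin n) ℝ) (p : ℕ)
    (B : Matrix (Fin m) (Fin n) ℝ) : Prop :=
  ∃ u v, IsSVD A u v ∧
    B = ∑ i ∈ Finset.univ.filter (fun i : Fin A.rank => (i : ℕ) < p),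
      sv A ((i : ℕ) + 1) • Matrix.vecMulVec (u i).ofLp (v i).ofLp

/-- Every real matrix has a singular value decomposition in the above sense. -/
theorem exists_isSVD {m n : ℕ} (A : Matrix (Fin m) (Fin n) ℝ) : ∃ u v, IsSVD A u v := by
  set T := Matrix.toEuclideanLin A with hT
  have hn : Module.finrank ℝ (EuclideanSpace ℝ (Fin n)) = n := by simp
  have hrank : A.rank = Module.finrank ℝ T.range := by
    rw [Matrix.rank_eq_finrank_range_toLin A (EuclideanSpace.basisFun (Fin m) ℝ).toBasis
      (EuclideanSpace.basisFun (Fin n) ℝ).toBasis, hT, Matrix.toEuclideanLin_eq_toLin_orthonormal]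
  have hrn : A.rank ≤ n := by simpa using A.rank_le_width
  set b := T.isSymmetric_adjoint_comp_self.eigenvectorBasis hn with hb
  have hev : ∀ i : Fin n, (LinearMap.adjoint T) (T (b i)) = (T.singularValues i ^ 2) • b i := by
    intro i
    have := T.isSymmetric_adjoint_comp_self.apply_eigenvectorBasis hn i
    rw [T.sq_singularValues_fin hn]
    exact this
  have hin : ∀ i j : Fin n, inner ℝ (T (b i)) (T (b j))
      = if i = j then T.singularValues i ^ 2 else 0 := by
    intro i j
    rw [← LinearMap.adjoint_inner_left, hev, real_inner_smul_left,
      orthonormal_iff_ite.mp b.orthonormal i j]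
    simp
  have hpos : ∀ i : Fin A.rank, 0 < T.singularValues i := by
    intro i
    rw [T.singularValues_pos_iff_lt_finrank_range, ← hrank]
    exact i.2
  have hzero : ∀ i : Fin n, A.rank ≤ (i : ℕ) → T (b i) = 0 := by
    intro i hi
    have h0 : T.singularValues i = 0 := by
      rw [T.singularValues_eq_zero_iff_le_finrank_range, ← hrank]
      exact hi
    have := hin i i
    rw [if_pos rfl, h0] at this
    exact (inner_self_eq_zero (𝕜 := ℝ)).mp (by rw [this]; norm_num)
  refine ⟨fun i => (T.singularValues i)⁻¹ • T (b (Fin.castLE hrn i)),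
    fun i => b (Fin.castLE hrn i), ?_, ?_, ?_⟩
  · rw [orthonormal_iff_ite]
    intro i j
    rw [real_inner_smul_left, real_inner_smul_right, hin]
    have hi := (hpos i).ne'
    by_cases hij : i = j
    · subst hij
      simp
      field_simp
    · have : Fin.castLE hrn i ≠ Fin.castLE hrn j := fun h => hij (Fin.castLE_injective hrn h)
      simp [hij]
  · exact b.orthonormal.comp _ (Fin.castLE_injective hrn)
  · apply Matrix.toEuclideanLin.injective
    rw [← hT]
    apply b.toBasis.ext
    intro k
    rw [OrthonormalBasis.coe_toBasis, map_sum, LinearMap.sum_apply]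
    have hterm : ∀ i : Fin A.rank, (Matrix.toEuclideanLin (sv A ((i : ℕ) + 1) •
        Matrix.vecMulVec ((T.singularValues i)⁻¹ • T (b (Fin.castLE hrn i))).ofLp
          (b (Fin.castLE hrn i)).ofLp)) (b k)
        = if Fin.castLE hrn i = k then T (b k) else 0 := by
      intro i
      have hi := (hpos i).ne'
      have ho := orthonormal_iff_ite.mp b.orthonormal (Fin.castLE hrn i) k
      have hs : sv A ((i : ℕ) + 1) = T.singularValues i := by simp [sv, hT]
      rw [hs]
      have : (Matrix.toEuclideanLin (T.singularValues i •
        Matrix.vecMulVec ((T.singularValues i)⁻¹ • T (b (Fin.castLE hrn i))).ofLp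
          (b (Fin.castLE hrn i)).ofLp)) (b k)
          = (inner ℝ (b (Fin.castLE hrn i)) (b k)) • T (b (Fin.castLE hrn i)) := by
        ext l
        simp [Matrix.vecMulVec_mulVec, PiLp.inner_apply, dotProduct]
        field_simp
        congr 1
        exact Finset.sum_congr rfl fun _ _ => mul_comm _ _
      rw [this, ho]
      split_ifs with h
      · rw [h, one_smul]
      · rw [zero_smul]
    rw [Finset.sum_congr rfl fun i _ => hterm i]
    by_cases hk : (k : ℕ) < A.rank
    · rw [Finset.sum_eq_single (⟨k, hk⟩ : Fin A.rank)]
      · rw [if_pos (by ext; simp)]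
      · intro i _ hik
        rw [if_neg]
        rintro rfl
        exact hik (by ext; simp)
      · simp
    · rw [hzero k (not_lt.mp hk)]
      simp

/-- `ε₁ = ‖E‖ / σ_p`, with the spectral norm. -/
def epsOne {m n : ℕ} (A E : Matrix (Fin m) (Fin n) ℝ) (p : ℕ) : ℝ := ‖E‖ / sv A p

/-- `ε₂ = 1 / δ_p`. -/
def epsTwo {m n : ℕ} (A : Matrix (Fin m) (Fin n) ℝ) (p : ℕ) : ℝ := 1 / gap A p

/-- `η = ‖E‖² / (σ_p δ_p)`. -/
def eta {m n : ℕ} (A E : Matrix (Fin m) (Fin n) ℝ) (p : ℕ) : ℝ := ‖E‖ ^ 2 / (sv A p * gap A p)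

/-- The condition `max {p ε₁, r² t₁ ε₂, √(r η)} ≤ 1/96`, with `r = rank A`. -/
def C0 {m n : ℕ} (A E : Matrix (Fin m) (Fin n) ℝ) (p : ℕ) (t₁ : ℝ) : Prop :=
  max (max ((p : ℝ) * epsOne A E p) ((A.rank : ℝ) ^ 2 * t₁ * epsTwo A p))
    (Real.sqrt ((A.rank : ℝ) * eta A E p)) ≤ 1 / 96

/-- `E` is a `(K, σ)`-bounded random matrix: its entries are independent, centred random variables,
almost surely at most `K` in absolute value, with variances at most `σ²`. -/
structure IsBoundedRandomMatrix {Ω : Type*} [MeasurableSpace Ω] (μ : Measure Ω) {m n : ℕ}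
    (E : Ω → Matrix (Fin m) (Fin n) ℝ) (K σ : ℝ) : Prop where
  measurable_entry : ∀ i j, Measurable fun ω => E ω i j
  indep : iIndepFun (fun (ij : Fin m × Fin n) (ω : Ω) => E ω ij.1 ij.2) μ
  mean_zero : ∀ i j, ∫ ω, E ω i j ∂μ = 0
  bounded : ∀ᵐ ω ∂μ, ∀ i j, |E ω i j| ≤ K
  variance_le : ∀ i j, variance (fun ω => E ω i j) μ ≤ σ ^ 2

end

end LowRankPerturbation

set_option linter.unusedSectionVars false

/-! Write `B = A + E`, let `U`, `V` hold the singular vectors of `A`, and let `σ = σ_p`, `δ = δ_p`.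
The full noise `‖E‖` may be large compared with `δ`, but its compression `Uᵀ E V` is an `r × r`
matrix of bilinear forms in fixed unit vectors. By Bernstein each entry is at most `2 t₁` with high
probability, so the compression has norm at most `τ = 2 r t₁`. Everything else is deterministic:
since `A` vanishes outside the spans of `U` and `V`, the rest of `E` affects the singular structure
only through second-order terms of size `‖E‖² / σ`.

Two facts carry the deterministic part. Eckart–Young type arguments give `σ_p(B) ≥ σ - τ` and
`σ_{p+1}(B)² ≤ (σ_{p+1} + τ)² + 2 ‖E‖²`, so a gap proportional to `δ` survives. A `sin Θ` argument
(`norm_cross_block_le`) bounds the cross terms between a block of `A` and a block of `B` by noise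
over gap. For blocks of `B` with singular values of order `σ`, `norm_block_mul_sub_mul_block_le`
replaces the noise `‖E‖` by `τ + O(‖E‖² / σ)`.

Finally `B_p - A_p` splits into five pieces (`IsMatrixSVD.norm_mul_blockProj_sub_le`). Singular
values of `B` below `σ / 2` are separated from those of the leading block of `A` by `σ / 2`, so the
crude noise bound costs only `O(‖E‖)`. Those in the band from `σ / 2` up to `σ_{p+1}(B)` see the gap
`δ` but only the refined noise. When `p = r` no randomness is needed. -/

namespace LowRankPerturbation

/-! ### Spectral norm estimates. -/

section Norms

variable {m n ι : Type*} [Fintype m] [Fintype n] [Fintype ι]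
  [DecidableEq m] [DecidableEq n] [DecidableEq ι]

theorem l2_opNorm_transpose (M : Matrix m n ℝ) : ‖M.transpose‖ = ‖M‖ := by
  rw [← Matrix.conjTranspose_eq_transpose_of_trivial, Matrix.l2_opNorm_conjTranspose]

theorem l2_opNorm_transpose_mul_self (M : Matrix m n ℝ) :
    ‖M.transpose * M‖ = ‖M‖ ^ 2 := by
  rw [← Matrix.conjTranspose_eq_transpose_of_trivial, Matrix.l2_opNorm_conjTranspose_mul_self, sq]

theorem l2_opNorm_diagonal_le {d : ι → ℝ} {b : ℝ} (hb : 0 ≤ b) (hd : ∀ i, |d i| ≤ b) :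
    ‖Matrix.diagonal d‖ ≤ b := by
  rw [Matrix.l2_opNorm_diagonal]
  exact (pi_norm_le_iff_of_nonneg hb).mpr hd

theorem l2_opNorm_one_le : ‖(1 : Matrix ι ι ℝ)‖ ≤ 1 := by
  rw [← Matrix.diagonal_one]
  exact l2_opNorm_diagonal_le zero_le_one fun i => by simp

theorem l2_opNorm_le_one_of_transpose_mul_self {U : Matrix m ι ℝ} (hU : U.transpose * U = 1) :
    ‖U‖ ≤ 1 := by
  have h := l2_opNorm_transpose_mul_self U
  rw [hU] at h
  have h1 := l2_opNorm_one_le (ι := ι)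
  have h2 := norm_nonneg U
  nlinarith

theorem l2_opNorm_le_one_of_isIdempotent {P : Matrix m m ℝ} (hs : P.transpose = P)
    (hi : P * P = P) : ‖P‖ ≤ 1 := by
  have h := l2_opNorm_transpose_mul_self P
  rw [hs, hi] at h
  have h2 := norm_nonneg P
  nlinarith

theorem norm_mul_le_of_le_one_left {P : Matrix m m ℝ} (hP : ‖P‖ ≤ 1) (M : Matrix m n ℝ) :
    ‖P * M‖ ≤ ‖M‖ :=
  (Matrix.l2_opNorm_mul P M).trans (mul_le_of_le_one_left (norm_nonneg _) hP)

theorem norm_mul_le_of_le_one_right {Q : Matrix n n ℝ} (hQ : ‖Q‖ ≤ 1) (M : Matrix m n ℝ) :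
    ‖M * Q‖ ≤ ‖M‖ :=
  (Matrix.l2_opNorm_mul M Q).trans (mul_le_of_le_one_right (norm_nonneg _) hQ)

theorem norm_mul_mul_transpose_le {κ : Type*} [Fintype κ] [DecidableEq κ] {U : Matrix m ι ℝ}
    {V : Matrix n κ ℝ} (hU : U.transpose * U = 1) (hV : V.transpose * V = 1) (D : Matrix ι κ ℝ) :
    ‖U * D * V.transpose‖ ≤ ‖D‖ := by
  have h1 := l2_opNorm_le_one_of_transpose_mul_self hU
  have h2 := l2_opNorm_le_one_of_transpose_mul_self hV
  rw [← l2_opNorm_transpose] at h2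
  calc _ ≤ ‖U * D‖ * ‖V.transpose‖ := Matrix.l2_opNorm_mul _ _
    _ ≤ ‖U * D‖ := mul_le_of_le_one_right (norm_nonneg _) h2
    _ ≤ ‖U‖ * ‖D‖ := Matrix.l2_opNorm_mul _ _
    _ ≤ ‖D‖ := mul_le_of_le_one_left (norm_nonneg _) h1

theorem norm_transpose_mul_mul_le {κ : Type*} [Fintype κ] [DecidableEq κ] {U : Matrix m ι ℝ}
    {V : Matrix n κ ℝ} (hU : U.transpose * U = 1) (hV : V.transpose * V = 1) (M : Matrix m n ℝ) :
    ‖U.transpose * M * V‖ ≤ ‖M‖ := by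
  have h1 := l2_opNorm_le_one_of_transpose_mul_self hU
  have h2 := l2_opNorm_le_one_of_transpose_mul_self hV
  rw [← l2_opNorm_transpose] at h1
  calc _ ≤ ‖U.transpose * M‖ * ‖V‖ := Matrix.l2_opNorm_mul _ _
    _ ≤ ‖U.transpose * M‖ := mul_le_of_le_one_right (norm_nonneg _) h2
    _ ≤ ‖U.transpose‖ * ‖M‖ := Matrix.l2_opNorm_mul _ _
    _ ≤ ‖M‖ := mul_le_of_le_one_left (norm_nonneg _) h1

/-- Pythagoras for the Gram matrix: `Mᵀ M` is the sum of the Gram matrices of `P M` and `(1 - P) M`,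
and `‖Mᵀ M‖ = ‖M‖²`. -/
theorem norm_sq_le_add_of_projection_left {P : Matrix m m ℝ} (hs : P.transpose = P)
    (hi : P * P = P) (M : Matrix m n ℝ) : ‖M‖ ^ 2 ≤ ‖P * M‖ ^ 2 + ‖(1 - P) * M‖ ^ 2 := by
  have hi' : (1 - P) * (1 - P) = 1 - P := by
    exact (IsIdempotentElem.one_sub hi)
  have key : M.transpose * M = (P * M).transpose * (P * M)
      + ((1 - P) * M).transpose * ((1 - P) * M) := by
    simp only [Matrix.transpose_mul, Matrix.transpose_sub, hs, Matrix.transpose_one]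
    rw [Matrix.mul_assoc, ← Matrix.mul_assoc P P, hi, Matrix.mul_assoc, ← Matrix.mul_assoc (1 - P),
      hi', ← Matrix.mul_add, ← Matrix.add_mul, add_sub_cancel, Matrix.one_mul]
  rw [← l2_opNorm_transpose_mul_self, ← l2_opNorm_transpose_mul_self,
    ← l2_opNorm_transpose_mul_self, key]
  exact norm_add_le _ _

theorem norm_sq_le_add_of_projection_right {Q : Matrix n n ℝ} (hs : Q.transpose = Q)
    (hi : Q * Q = Q) (M : Matrix m n ℝ) : ‖M‖ ^ 2 ≤ ‖M * Q‖ ^ 2 + ‖M * (1 - Q)‖ ^ 2 := by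
  have h := norm_sq_le_add_of_projection_left hs hi M.transpose
  rw [← l2_opNorm_transpose, ← l2_opNorm_transpose (Q * _),
    ← l2_opNorm_transpose ((1 - Q) * _)] at h
  simpa [Matrix.transpose_mul, Matrix.transpose_sub, hs] using h

theorem l2_opNorm_le_of_forall {M : Matrix m n ℝ} {b : ℝ} (hb : 0 ≤ b)
    (h : ∀ x : EuclideanSpace ℝ n, ‖WithLp.toLp 2 (M.mulVec x.ofLp)‖ ≤ b * ‖x‖) : ‖M‖ ≤ b := by
  rw [Matrix.l2_opNorm_def]
  exact ContinuousLinearMap.opNorm_le_bound _ hb h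

/-- A square matrix with entries at most `c` in absolute value has spectral norm at most
its size times `c`. -/
theorem l2_opNorm_le_card_mul {M : Matrix ι ι ℝ} {c : ℝ} (hc : 0 ≤ c)
    (hM : ∀ i j, |M i j| ≤ c) : ‖M‖ ≤ Fintype.card ι * c := by
  refine l2_opNorm_le_of_forall (by positivity) fun x => ?_
  refine abs_le_of_sq_le_sq' ?_ (by positivity) |>.2
  rw [EuclideanSpace.norm_sq_eq, mul_pow, EuclideanSpace.norm_sq_eq]
  have h1 : ∀ i, ‖(WithLp.toLp 2 (M.mulVec x.ofLp) : EuclideanSpace ℝ ι) i‖ ^ 2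
      ≤ Fintype.card ι * c ^ 2 * ∑ j, ‖x j‖ ^ 2 := by
    intro i
    have h2 : ∑ j, M i j ^ 2 ≤ Fintype.card ι * c ^ 2 := by
      calc _ ≤ ∑ _j : ι, c ^ 2 := Finset.sum_le_sum fun j _ => sq_le_sq' (by
              linarith [neg_abs_le (M i j), hM i j]) (by linarith [le_abs_self (M i j), hM i j])
        _ = _ := by simp
    -- Cauchy–Schwarz in each row; summing over the rows gives the second factor of the size.
    have h3 := Finset.sum_mul_sq_le_sq_mul_sq Finset.univ (fun j => M i j) (fun j => x j)
    simp only [Real.norm_eq_abs, sq_abs, Matrix.mulVec, dotProduct]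
    exact h3.trans (mul_le_mul_of_nonneg_right h2 (Finset.sum_nonneg fun j _ => sq_nonneg _))
  calc _ ≤ ∑ _i : ι, Fintype.card ι * c ^ 2 * ∑ j, ‖x j‖ ^ 2 := Finset.sum_le_sum fun i _ => h1 i
    _ = _ := by simp; ring

/-- A rank-deficient `N` kills some nonzero vector, and on that vector `diagonal d - N` acts as
`diagonal d`, which stretches it by at least `c`. -/
theorem le_norm_diagonal_sub {d : ι → ℝ} {c : ℝ} (hc : 0 ≤ c) (hd : ∀ i, c ≤ d i)
    {N : Matrix ι ι ℝ} (hN : N.rank < Fintype.card ι) : c ≤ ‖Matrix.diagonal d - N‖ := by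
  have hdet : N.det = 0 := by
    by_contra h
    exact hN.ne (Matrix.rank_of_isUnit N ((Matrix.isUnit_iff_isUnit_det N).mpr
      (isUnit_iff_ne_zero.mpr h)))
  obtain ⟨x, hx0, hx⟩ := Matrix.exists_mulVec_eq_zero_iff.mpr hdet
  set y : EuclideanSpace ℝ ι := WithLp.toLp 2 x with hy
  have hy0 : 0 < ‖y‖ := norm_pos_iff.mpr fun h => hx0 (by simpa [hy] using h)
  have h1 := Matrix.l2_opNorm_mulVec (Matrix.diagonal d - N) y
  have h2 : c * ‖y‖ ≤ ‖(WithLp.toLp 2 ((Matrix.diagonal d - N).mulVec y.ofLp) :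
      EuclideanSpace ℝ ι)‖ := by
    refine abs_le_of_sq_le_sq' ?_ (by positivity) |>.2
    rw [EuclideanSpace.norm_sq_eq, mul_pow, EuclideanSpace.norm_sq_eq, Finset.mul_sum]
    refine Finset.sum_le_sum fun i _ => ?_
    simp only [hy, Matrix.sub_mulVec, hx, sub_zero, Matrix.mulVec_diagonal, norm_mul, mul_pow]
    refine mul_le_mul_of_nonneg_right ?_ (sq_nonneg _)
    rw [Real.norm_eq_abs, sq_abs]
    exact pow_le_pow_left₀ hc (hd i) 2
  exact le_of_mul_le_mul_right (h2.trans h1) hy0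

end Norms

/-! ### Singular blocks, the gap estimate for cross terms, and rank obstructions. -/

section Blocks

variable {m n ι : Type*} [Fintype m] [Fintype n] [Fintype ι]
  [DecidableEq m] [DecidableEq n] [DecidableEq ι]

/-- `P`, `Q` are orthogonal projections which split off a block of `M`. -/
structure IsReducing (M : Matrix m n ℝ) (P : Matrix m m ℝ) (Q : Matrix n n ℝ) : Prop where
  left_symm : P.transpose = P
  left_idem : P * P = P
  right_symm : Q.transpose = Q
  right_idem : Q * Q = Q
  comm : P * M = M * Q

/-- The block `P * M = M * Q` of `M` has all its singular values at least `c`. -/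
structure IsBoundedBelow (M : Matrix m n ℝ) (P : Matrix m m ℝ) (Q : Matrix n n ℝ) (c : ℝ) :
    Prop where
  left : ∀ Z : Matrix m m ℝ, c * ‖Z * P‖ ≤ ‖Z * M * Q‖
  right : ∀ Z : Matrix n n ℝ, c * ‖Q * Z‖ ≤ ‖P * M * Z‖

namespace IsReducing

variable {M : Matrix m n ℝ} {P : Matrix m m ℝ} {Q : Matrix n n ℝ}

theorem norm_left_le (h : IsReducing M P Q) : ‖P‖ ≤ 1 :=
  l2_opNorm_le_one_of_isIdempotent h.left_symm h.left_idem

theorem norm_right_le (h : IsReducing M P Q) : ‖Q‖ ≤ 1 :=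
  l2_opNorm_le_one_of_isIdempotent h.right_symm h.right_idem

theorem compl (h : IsReducing M P Q) : IsReducing M (1 - P) (1 - Q) where
  left_symm := by rw [Matrix.transpose_sub, h.left_symm, Matrix.transpose_one]
  left_idem := IsIdempotentElem.one_sub h.left_idem
  right_symm := by rw [Matrix.transpose_sub, h.right_symm, Matrix.transpose_one]
  right_idem := IsIdempotentElem.one_sub h.right_idem
  comm := by rw [Matrix.sub_mul, Matrix.mul_sub, h.comm, Matrix.one_mul, Matrix.mul_one]

end IsReducing

/-- Two matrices `M`, `M'` with blocks separated by a gap: the singular values of the block of `M`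
are at least `c` and those of the block of `M'` are at most `b < c`. -/
theorem norm_cross_block_le {M M' : Matrix m n ℝ} {P P' : Matrix m m ℝ} {Q Q' : Matrix n n ℝ}
    {b c f : ℝ} (h : IsReducing M P Q) (h' : IsReducing M' P' Q') (hc : IsBoundedBelow M P Q c)
    (hb0 : 0 ≤ b) (hbc : b < c) (hb : ‖M' * Q'‖ ≤ b) (hf : ‖P' * (M - M') * Q‖ ≤ f)
    (hf' : ‖P * (M - M') * Q'‖ ≤ f) :
    (c - b) * ‖P' * M * Q‖ ≤ c * f ∧ (c - b) * ‖P * M * Q'‖ ≤ c * f := by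
  have hx : ‖P' * M * Q‖ ≤ b * ‖Q * Q'‖ + f := by
    have e : P' * M * Q = (M' * Q') * (Q' * Q) + P' * (M - M') * Q := by
      rw [Matrix.mul_sub, Matrix.sub_mul, h'.comm, Matrix.mul_assoc M' Q', ← Matrix.mul_assoc Q' Q',
        h'.right_idem, Matrix.mul_assoc M', add_sub_cancel]
    have e2 : ‖Q' * Q‖ = ‖Q * Q'‖ := by
      rw [← l2_opNorm_transpose, Matrix.transpose_mul, h.right_symm, h'.right_symm]
    rw [e]
    refine (norm_add_le _ _).trans (add_le_add ((Matrix.l2_opNorm_mul _ _).trans ?_) hf)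
    rw [e2]
    exact mul_le_mul_of_nonneg_right hb (norm_nonneg _)
  have hy : ‖P * M * Q'‖ ≤ b * ‖P' * P‖ + f := by
    have e : P * M * Q' = (P * P') * (M' * Q') + P * (M - M') * Q' := by
      rw [Matrix.mul_sub, Matrix.sub_mul, ← h'.comm, Matrix.mul_assoc P P', ← Matrix.mul_assoc P' P',
        h'.left_idem, h'.comm, Matrix.mul_assoc P M', add_sub_cancel]
    have e2 : ‖P' * P‖ = ‖P * P'‖ := by
      rw [← l2_opNorm_transpose, Matrix.transpose_mul, h.left_symm, h'.left_symm]
    rw [e]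
    refine (norm_add_le _ _).trans (add_le_add ((Matrix.l2_opNorm_mul _ _).trans ?_) hf')
    rw [e2, mul_comm]
    exact mul_le_mul_of_nonneg_right hb (norm_nonneg _)
  have h1 := hc.left P'
  have h2 := hc.right Q'
  have hcb : 0 < c + b := by linarith
  have hc0 : 0 < c := by linarith
  -- Neither cross term is bounded alone: each controls the other through the angle between the two
  -- subspaces, with ratio `b / c < 1`.
  have a1 : c * ‖P' * M * Q‖ ≤ b * ‖P * M * Q'‖ + c * f := by
    have := mul_le_mul_of_nonneg_left h2 hb0
    have := mul_le_mul_of_nonneg_left hx hc0.le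
    nlinarith
  have a2 : c * ‖P * M * Q'‖ ≤ b * ‖P' * M * Q‖ + c * f := by
    have := mul_le_mul_of_nonneg_left h1 hb0
    have := mul_le_mul_of_nonneg_left hy hc0.le
    nlinarith
  -- Eliminating one unknown leaves the factor `c² - b²` against `(c + b) c f`, and `c + b` cancels.
  constructor
  · refine le_of_mul_le_mul_left ?_ hcb
    linarith [mul_le_mul_of_nonneg_left a1 hc0.le, mul_le_mul_of_nonneg_left a2 hb0]
  · refine le_of_mul_le_mul_left ?_ hcb
    linarith [mul_le_mul_of_nonneg_left a2 hc0.le, mul_le_mul_of_nonneg_left a1 hb0]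

/-- The orthogonal projection onto the span of the columns `i` of `U` with `S i`. -/
noncomputable def blockProj (U : Matrix m ι ℝ) (S : ι → Prop) [DecidablePred S] : Matrix m m ℝ :=
  U * Matrix.diagonal (fun i => if S i then (1 : ℝ) else 0) * U.transpose

theorem mul_diagonal_mul_mul {κ : Type*} [Fintype κ] {U : Matrix m ι ℝ} {V : Matrix n ι ℝ}
    {W : Matrix κ ι ℝ} (hV : V.transpose * V = 1) (d e : ι → ℝ) :
    (U * Matrix.diagonal d * V.transpose) * (V * Matrix.diagonal e * W.transpose)
      = U * Matrix.diagonal (fun i => d i * e i) * W.transpose := by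
  rw [← Matrix.diagonal_mul_diagonal]
  calc _ = U * Matrix.diagonal d * (V.transpose * V) * Matrix.diagonal e * W.transpose := by
        simp only [Matrix.mul_assoc]
    _ = _ := by rw [hV, Matrix.mul_one]; simp only [Matrix.mul_assoc]

variable {U : Matrix m ι ℝ} {V : Matrix n ι ℝ} {d : ι → ℝ} {S : ι → Prop} [DecidablePred S]

theorem blockProj_mul (hU : U.transpose * U = 1) :
    blockProj U S * (U * Matrix.diagonal d * V.transpose)
      = U * Matrix.diagonal (fun i => if S i then d i else 0) * V.transpose := by
  rw [blockProj, mul_diagonal_mul_mul hU]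
  simp

theorem mul_blockProj (hV : V.transpose * V = 1) :
    (U * Matrix.diagonal d * V.transpose) * blockProj V S
      = U * Matrix.diagonal (fun i => if S i then d i else 0) * V.transpose := by
  rw [blockProj, mul_diagonal_mul_mul hV]
  simp

theorem blockProj_symm : (blockProj U S).transpose = blockProj U S := by
  simp [blockProj, Matrix.transpose_mul, Matrix.mul_assoc]

theorem blockProj_idem (hU : U.transpose * U = 1) :
    blockProj U S * blockProj U S = blockProj U S := by
  rw [blockProj, mul_diagonal_mul_mul hU]
  simp only [mul_ite, mul_one, mul_zero]
  congr 3
  funext i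
  by_cases h : S i <;> simp [h]

theorem blockProj_mul_of_disjoint (hU : U.transpose * U = 1) {T : ι → Prop} [DecidablePred T]
    (hST : ∀ i, S i → ¬ T i) : blockProj U S * blockProj U T = 0 := by
  rw [blockProj, blockProj, mul_diagonal_mul_mul hU]
  have : (fun i => (if S i then (1 : ℝ) else 0) * (if T i then 1 else 0)) = 0 := by
    funext i
    by_cases h : S i
    · simp [hST i h]
    · simp [h]
  rw [this]
  simp

theorem isReducing_blockProj (hU : U.transpose * U = 1) (hV : V.transpose * V = 1) :
    IsReducing (U * Matrix.diagonal d * V.transpose) (blockProj U S) (blockProj V S) where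
  left_symm := blockProj_symm
  left_idem := blockProj_idem hU
  right_symm := blockProj_symm
  right_idem := blockProj_idem hV
  comm := by rw [blockProj_mul hU, mul_blockProj hV]

theorem norm_mul_blockProj_le (hU : U.transpose * U = 1) (hV : V.transpose * V = 1) {b : ℝ}
    (hb : 0 ≤ b) (hd : ∀ i, S i → |d i| ≤ b) :
    ‖(U * Matrix.diagonal d * V.transpose) * blockProj V S‖ ≤ b := by
  rw [mul_blockProj hV]
  refine (norm_mul_mul_transpose_le hU hV _).trans (l2_opNorm_diagonal_le hb fun i => ?_)
  split_ifs with h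
  · exact hd i h
  · simpa using hb

theorem norm_mul_one_sub_blockProj_le (hU : U.transpose * U = 1) (hV : V.transpose * V = 1) {b : ℝ}
    (hb : 0 ≤ b) (hd : ∀ i, ¬ S i → |d i| ≤ b) :
    ‖(U * Matrix.diagonal d * V.transpose) * (1 - blockProj V S)‖ ≤ b := by
  have : (U * Matrix.diagonal d * V.transpose) * (1 - blockProj V S)
      = (U * Matrix.diagonal d * V.transpose) * blockProj V (fun i => ¬ S i) := by
    rw [Matrix.mul_sub, mul_blockProj hV, mul_blockProj hV, Matrix.mul_one, ← Matrix.sub_mul,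
      ← Matrix.mul_sub, Matrix.diagonal_sub]
    congr 3
    funext i
    by_cases h : S i <;> simp [h]
  rw [this]
  exact norm_mul_blockProj_le hU hV hb hd

theorem isBoundedBelow_blockProj (hU : U.transpose * U = 1) (hV : V.transpose * V = 1) {c : ℝ}
    (hc : 0 < c) (hd : ∀ i, S i → c ≤ d i) :
    IsBoundedBelow (U * Matrix.diagonal d * V.transpose) (blockProj U S) (blockProj V S) c := by
  set M := U * Matrix.diagonal d * V.transpose
  -- The pseudo-inverse of the block, of norm at most `1 / c`; undoing the block with it gives both
  -- lower bounds.
  set B := V * Matrix.diagonal (fun i => if S i then (d i)⁻¹ else 0) * U.transpose with hBdef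
  have hB : ‖B‖ ≤ c⁻¹ := by
    refine (norm_mul_mul_transpose_le hV hU _).trans (l2_opNorm_diagonal_le (by positivity)
      fun i => ?_)
    split_ifs with h
    · have := hd i h
      rw [abs_of_nonneg (inv_nonneg.mpr (hc.le.trans this))]
      exact inv_anti₀ hc this
    · simpa using hc.le
  have h1 : M * blockProj V S * B = blockProj U S := by
    rw [mul_blockProj hV, hBdef, mul_diagonal_mul_mul hV, blockProj]
    congr 3
    funext i
    by_cases h : S i
    · have := (hc.trans_le (hd i h)).ne'
      simp [h, this]
    · simp [h]
  have h2 : B * (blockProj U S * M) = blockProj V S := by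
    rw [blockProj_mul hU, hBdef, mul_diagonal_mul_mul hU, blockProj]
    congr 3
    funext i
    by_cases h : S i
    · have := (hc.trans_le (hd i h)).ne'
      simp [h, this]
    · simp [h]
  refine ⟨fun Z => ?_, fun Z => ?_⟩
  · have e : Z * blockProj U S = Z * M * blockProj V S * B := by
      rw [← h1]; simp only [Matrix.mul_assoc]
    rw [e]
    have := (Matrix.l2_opNorm_mul (Z * M * blockProj V S) B).trans
      (mul_le_mul_of_nonneg_left hB (norm_nonneg _))
    calc _ ≤ c * (‖Z * M * blockProj V S‖ * c⁻¹) := mul_le_mul_of_nonneg_left this hc.le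
      _ = _ := by rw [mul_comm, mul_assoc, inv_mul_cancel₀ hc.ne', mul_one]
  · have e : blockProj V S * Z = B * (blockProj U S * M * Z) := by
      rw [← h2]; simp only [Matrix.mul_assoc]
    rw [e]
    have := (Matrix.l2_opNorm_mul B (blockProj U S * M * Z)).trans
      (mul_le_mul_of_nonneg_right hB (norm_nonneg _))
    calc _ ≤ c * (c⁻¹ * ‖blockProj U S * M * Z‖) := mul_le_mul_of_nonneg_left this hc.le
      _ = _ := by rw [← mul_assoc, mul_inv_cancel₀ hc.ne', one_mul]

theorem rank_mul_blockProj_le {M : Matrix m n ℝ} :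
    (M * blockProj V S).rank ≤ Fintype.card {i // S i} := by
  refine (Matrix.rank_mul_le_right _ _).trans ((Matrix.rank_mul_le_left _ _).trans
    ((Matrix.rank_mul_le_right _ _).trans ?_))
  rw [Matrix.rank_diagonal]
  refine Fintype.card_le_of_injective (fun i => ⟨i.1, by
    by_contra h
    exact i.2 (if_neg h)⟩) fun i j hij => Subtype.ext (by simpa using hij)

theorem transpose_submatrix_mul_mul (M : Matrix m n ℝ) :
    (U.submatrix id (Subtype.val : {i // S i} → ι)).transpose * M *
      V.submatrix id (Subtype.val : {i // S i} → ι)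
      = (U.transpose * M * V).submatrix Subtype.val Subtype.val := by
  rw [← Matrix.submatrix_mul_equiv _ V _ (Equiv.refl n),
    ← Matrix.submatrix_mul_equiv _ M _ (Equiv.refl m)]
  rfl

theorem transpose_submatrix_mul_self (hU : U.transpose * U = 1) :
    (U.submatrix id (Subtype.val : {i // S i} → ι)).transpose *
      U.submatrix id (Subtype.val : {i // S i} → ι) = 1 := by
  have h := transpose_submatrix_mul_mul (U := U) (V := U) (S := S) 1
  rwa [Matrix.mul_one, Matrix.mul_one, hU,
    Matrix.submatrix_one _ Subtype.val_injective] at h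

theorem transpose_submatrix_mul_svd_mul (hU : U.transpose * U = 1) (hV : V.transpose * V = 1) :
    (U.submatrix id (Subtype.val : {i // S i} → ι)).transpose *
      (U * Matrix.diagonal d * V.transpose) * V.submatrix id (Subtype.val : {i // S i} → ι)
      = Matrix.diagonal fun i : {i // S i} => d i := by
  have : U.transpose * (U * Matrix.diagonal d * V.transpose) * V = Matrix.diagonal d := by
    calc _ = (U.transpose * U) * Matrix.diagonal d * (V.transpose * V) := by
          simp only [Matrix.mul_assoc]
      _ = _ := by rw [hU, hV, Matrix.one_mul, Matrix.mul_one]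
  rw [transpose_submatrix_mul_mul, this, Matrix.submatrix_diagonal _ _ Subtype.val_injective]
  rfl

/-- A perturbation moves the smallest singular value of a block by no more than the norm of its
compression to the singular subspaces. -/
theorem le_norm_sub_add_of_rank_lt (hU : U.transpose * U = 1) (hV : V.transpose * V = 1) {c : ℝ}
    (hc : 0 ≤ c) (hd : ∀ i, S i → c ≤ d i) {B C : Matrix m n ℝ}
    (hC : C.rank < Fintype.card {i // S i}) :
    c ≤ ‖B - C‖
      + ‖U.transpose * (B - U * Matrix.diagonal d * V.transpose) * V‖ := by
  set M := U * Matrix.diagonal d * V.transpose with hM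
  set X := (U.submatrix id (Subtype.val : {i // S i} → ι)) with hX
  set Y := (V.submatrix id (Subtype.val : {i // S i} → ι)) with hY
  have hXX : X.transpose * X = 1 := transpose_submatrix_mul_self hU
  have hYY : Y.transpose * Y = 1 := transpose_submatrix_mul_self hV
  refine (le_norm_diagonal_sub (d := fun i : {i // S i} => d i) hc (fun i => hd i i.2)
    (N := X.transpose * C * Y)
    (((Matrix.rank_mul_le_left _ _).trans (Matrix.rank_mul_le_right _ _)).trans_lt hC)).trans ?_
  have e : Matrix.diagonal (fun i : {i // S i} => d i) - X.transpose * C * Y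
      = X.transpose * (B - C) * Y - X.transpose * (B - M) * Y := by
    rw [← transpose_submatrix_mul_svd_mul hU hV, ← hM, ← hX, ← hY]
    simp only [Matrix.mul_sub, Matrix.sub_mul]
    abel
  rw [e]
  refine (norm_sub_le _ _).trans (add_le_add (norm_transpose_mul_mul_le hXX hYY _) ?_)
  -- Compressing to the columns in `S` is a further compression of `Uᵀ (B - M) V` by coordinate
  -- inclusions, which are isometries.
  have e2 : X.transpose * (B - M) * Y = (1 : Matrix ι ι ℝ).submatrix Subtype.val id *
      (U.transpose * (B - M) * V) * (1 : Matrix ι ι ℝ).submatrix id Subtype.val := by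
    rw [hX, hY, transpose_submatrix_mul_mul]
    ext i j
    simp [Matrix.mul_apply, Matrix.one_apply]
  have h1 := norm_transpose_mul_mul_le (transpose_submatrix_mul_self (S := S)
    (U := (1 : Matrix ι ι ℝ)) (by simp)) (transpose_submatrix_mul_self (S := S)
    (U := (1 : Matrix ι ι ℝ)) (by simp)) (U.transpose * (B - M) * V)
  rw [e2]
  simpa [Matrix.transpose_submatrix] using h1

/-- Subtracting a matrix of small rank cannot bring all singular values of a block below the
smallest one. -/
theorem le_norm_svd_sub_of_rank_lt (hU : U.transpose * U = 1) (hV : V.transpose * V = 1) {c : ℝ}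
    (hc : 0 ≤ c) (hd : ∀ i, S i → c ≤ d i) {C : Matrix m n ℝ}
    (hC : C.rank < Fintype.card {i // S i}) :
    c ≤ ‖U * Matrix.diagonal d * V.transpose - C‖ := by
  simpa using le_norm_sub_add_of_rank_lt hU hV hc hd (B := U * Matrix.diagonal d * V.transpose) hC

end Blocks

/-! ### Second-order effect of the perturbation outside the singular subspaces. -/

section Blocks

variable {m n ι : Type*} [Fintype m] [Fintype n] [Fintype ι]
  [DecidableEq m] [DecidableEq n] [DecidableEq ι]

theorem blockProj_eq_add (U : Matrix m ι ℝ) {S T W : ι → Prop} [DecidablePred S] [DecidablePred T]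
    [DecidablePred W] (hW : ∀ i, W i ↔ S i ∨ T i) (hST : ∀ i, S i → ¬ T i) :
    blockProj U W = blockProj U S + blockProj U T := by
  rw [blockProj, blockProj, blockProj, ← Matrix.add_mul, ← Matrix.mul_add, Matrix.diagonal_add]
  congr 3
  funext i
  by_cases h : S i
  · simp [hW, h, hST i h]
  · simp [hW, h]

theorem blockProj_true (U : Matrix m ι ℝ) : blockProj U (fun _ => True) = U * U.transpose := by
  simp [blockProj]

theorem blockProj_mul_mul_transpose {U : Matrix m ι ℝ} (hU : U.transpose * U = 1) {S : ι → Prop}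
    [DecidablePred S] : blockProj U S * (U * U.transpose) = blockProj U S := by
  rw [← blockProj_true, blockProj, blockProj, mul_diagonal_mul_mul hU]
  simp

theorem mul_transpose_mul_blockProj {U : Matrix m ι ℝ} (hU : U.transpose * U = 1) {S : ι → Prop}
    [DecidablePred S] : (U * U.transpose) * blockProj U S = blockProj U S := by
  rw [← blockProj_true, blockProj, blockProj, mul_diagonal_mul_mul hU]
  simp

theorem norm_one_sub_mul_transpose_le {U : Matrix m ι ℝ} (hU : U.transpose * U = 1) :
    ‖1 - U * U.transpose‖ ≤ 1 := by
  rw [← blockProj_true]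
  exact (isReducing_blockProj (d := 0) hU hU).compl.norm_left_le

/-- If the part of `A` outside of the column spaces of `U`, `V` vanishes, the difference `B - A`
is small between a block of `A` and a block of `B` whose singular values are at least `c`. -/
theorem norm_block_mul_sub_mul_block_le {A B : Matrix m n ℝ} {U : Matrix m ι ℝ} {V : Matrix n ι ℝ}
    (hU : U.transpose * U = 1) (hV : V.transpose * V = 1)
    (hUA : (1 - U * U.transpose) * A = 0) (hAV : A * (1 - V * V.transpose) = 0) {τ c : ℝ}
    (hτ : ‖U.transpose * (B - A) * V‖ ≤ τ) {P' : Matrix m m ℝ} {Q' : Matrix n n ℝ}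
    (h' : IsReducing B P' Q') (hc : IsBoundedBelow B P' Q' c) (hc0 : 0 < c)
    {S : ι → Prop} [DecidablePred S] :
    ‖P' * (B - A) * blockProj V S‖ ≤ τ + ‖B - A‖ ^ 2 / c ∧
      ‖blockProj U S * (B - A) * Q'‖ ≤ τ + ‖B - A‖ ^ 2 / c := by
  set E := B - A with hE
  have hP : ‖blockProj U S‖ ≤ 1 := (isReducing_blockProj (d := 0) hU hU).norm_left_le
  have hQ : ‖blockProj V S‖ ≤ 1 := (isReducing_blockProj (d := 0) hV hV).norm_left_le
  have hcore : ‖U * U.transpose * E * (V * V.transpose)‖ ≤ τ := by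
    have := norm_mul_mul_transpose_le hU hV (U.transpose * E * V)
    refine (le_of_eq ?_).trans (this.trans hτ)
    simp only [Matrix.mul_assoc]
  have h3 := norm_one_sub_mul_transpose_le hU
  have h4 := norm_one_sub_mul_transpose_le hV
  -- The complement of the span of `U` kills `A`, so there `B` equals `E`. A block of `B` with
  -- singular values at least `c` can thus tilt out of that span by at most `‖E‖ / c`; multiplied by
  -- `E` once more, this is second order.
  have h5 : ‖P' * (1 - U * U.transpose)‖ ≤ ‖E‖ / c := by
    rw [le_div_iff₀ hc0, mul_comm]
    have e : ‖P' * (1 - U * U.transpose)‖ = ‖(1 - U * U.transpose) * P'‖ := by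
      rw [← l2_opNorm_transpose, Matrix.transpose_mul, h'.left_symm]
      simp
    rw [e]
    refine (hc.left _).trans ?_
    have e2 : (1 - U * U.transpose) * B = (1 - U * U.transpose) * E := by
      rw [hE, Matrix.mul_sub, hUA, sub_zero]
    rw [e2]
    exact (norm_mul_le_of_le_one_right h'.norm_right_le _).trans (norm_mul_le_of_le_one_left h3 _)
  have h6 : ‖(1 - V * V.transpose) * Q'‖ ≤ ‖E‖ / c := by
    rw [le_div_iff₀ hc0, mul_comm]
    have e : ‖(1 - V * V.transpose) * Q'‖ = ‖Q' * (1 - V * V.transpose)‖ := by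
      rw [← l2_opNorm_transpose, Matrix.transpose_mul, h'.right_symm]
      simp
    rw [e]
    refine (hc.right _).trans ?_
    have e2 : P' * B * (1 - V * V.transpose) = P' * (E * (1 - V * V.transpose)) := by
      rw [hE, Matrix.sub_mul, hAV, sub_zero, Matrix.mul_assoc]
    rw [e2]
    exact (norm_mul_le_of_le_one_left h'.norm_left_le _).trans (norm_mul_le_of_le_one_right h4 _)
  constructor
  · have e : P' * E * blockProj V S
        = P' * (U * U.transpose * E * (V * V.transpose)) * blockProj V S
          + (P' * (1 - U * U.transpose)) * E * blockProj V S := by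
      have e1 : P' * (U * U.transpose * E * (V * V.transpose)) * blockProj V S
          = P' * (U * U.transpose) * E * blockProj V S := by
        rw [Matrix.mul_assoc P', Matrix.mul_assoc (U * U.transpose * E),
          mul_transpose_mul_blockProj hV]
        simp only [Matrix.mul_assoc]
      rw [e1, ← Matrix.add_mul, ← Matrix.add_mul, ← Matrix.mul_add, add_sub_cancel, Matrix.mul_one]
    rw [e]
    refine (norm_add_le _ _).trans (add_le_add ?_ ?_)
    · exact (norm_mul_le_of_le_one_right hQ _).trans
        ((norm_mul_le_of_le_one_left h'.norm_left_le _).trans hcore)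
    · refine (norm_mul_le_of_le_one_right hQ _).trans ((Matrix.l2_opNorm_mul _ _).trans ?_)
      calc _ ≤ ‖E‖ / c * ‖E‖ := mul_le_mul_of_nonneg_right h5 (norm_nonneg _)
        _ = _ := by ring
  · have e : blockProj U S * E * Q'
        = blockProj U S * (U * U.transpose * E * (V * V.transpose)) * Q'
          + blockProj U S * (E * ((1 - V * V.transpose) * Q')) := by
      have e1 : blockProj U S * (U * U.transpose * E * (V * V.transpose)) * Q'
          = blockProj U S * (E * ((V * V.transpose) * Q')) := by
        rw [Matrix.mul_assoc (U * U.transpose), ← Matrix.mul_assoc (blockProj U S),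
          blockProj_mul_mul_transpose hU]
        simp only [Matrix.mul_assoc]
      rw [e1, ← Matrix.mul_add, ← Matrix.mul_add, ← Matrix.add_mul, add_sub_cancel, Matrix.one_mul,
        Matrix.mul_assoc]
    rw [e]
    refine (norm_add_le _ _).trans (add_le_add ?_ ?_)
    · exact (norm_mul_le_of_le_one_right h'.norm_right_le _).trans
        ((norm_mul_le_of_le_one_left hP _).trans hcore)
    · refine (norm_mul_le_of_le_one_left hP _).trans ((Matrix.l2_opNorm_mul _ _).trans ?_)
      calc _ ≤ ‖E‖ * (‖E‖ / c) := mul_le_mul_of_nonneg_left h6 (norm_nonneg _)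
        _ = _ := by ring

/-- Outside of the leading block `S`, a perturbation enters the spectral norm to second order
up to its compression to the singular subspaces. -/
theorem norm_mul_one_sub_blockProj_sq_le {B : Matrix m n ℝ} {U : Matrix m ι ℝ} {V : Matrix n ι ℝ}
    (hU : U.transpose * U = 1) (hV : V.transpose * V = 1) {d : ι → ℝ} {S : ι → Prop}
    [DecidablePred S] {s τ : ℝ} (hs0 : 0 ≤ s) (hs : ∀ i, ¬ S i → |d i| ≤ s)
    (hτ : ‖U.transpose * (B - U * Matrix.diagonal d * V.transpose) * V‖ ≤ τ) :
    ‖B * (1 - blockProj V S)‖ ^ 2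
      ≤ (s + τ) ^ 2 + 2 * ‖B - U * Matrix.diagonal d * V.transpose‖ ^ 2 := by
  set A := U * Matrix.diagonal d * V.transpose with hA
  set E := B - A with hE
  have hB : B = A + E := by rw [hE, add_sub_cancel]
  set P₂ := blockProj U (fun i => ¬ S i) with hP₂
  set Q₁ := blockProj V S with hQ₁
  set Q₂ := blockProj V (fun i => ¬ S i) with hQ₂
  have r₁ : IsReducing A (blockProj U S) Q₁ := isReducing_blockProj hU hV
  have r₂ : IsReducing A P₂ Q₂ := isReducing_blockProj hU hV
  have hQsum : V * V.transpose = Q₁ + Q₂ := by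
    rw [← blockProj_true]
    exact blockProj_eq_add V (fun i => by tauto) (fun i h => by tauto)
  have hQ12 : Q₁ * Q₂ = 0 := blockProj_mul_of_disjoint hV fun i h => by tauto
  have hAV : A * (1 - V * V.transpose) = 0 := by
    rw [Matrix.mul_sub, Matrix.mul_one, hA, Matrix.mul_assoc _ V.transpose,
      ← Matrix.mul_assoc V.transpose, hV, Matrix.one_mul, sub_self]
  have hA12 : A - A * Q₁ - A * Q₂ = 0 := by
    rw [sub_sub, ← Matrix.mul_add, ← hQsum]
    simpa [Matrix.mul_sub] using hAV
  -- `B (1 - Q₁)` is cut into three pieces by `P₂` and `Q₂`. Only the corner `P₂ · Q₂` contains a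
  -- part of `A`, and there `E` enters through its compression; the two other pieces consist of `E`
  -- alone.
  have h1 : ‖(1 - P₂) * (B * (1 - Q₁))‖ ≤ ‖E‖ := by
    have e : (1 - P₂) * (B * (1 - Q₁)) = (1 - P₂) * (E * (1 - Q₁)) := by
      have : (1 - P₂) * (A * (1 - Q₁)) = 0 := by
        rw [← Matrix.mul_assoc, r₂.compl.comm, Matrix.mul_assoc]
        simp only [Matrix.mul_sub, Matrix.sub_mul, Matrix.mul_one, Matrix.one_mul]
        have hQ21 : Q₂ * Q₁ = 0 := blockProj_mul_of_disjoint hV fun i h => by tauto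
        rw [hQ21, Matrix.mul_zero, sub_zero, sub_right_comm, hA12]
      rw [hB, Matrix.add_mul, Matrix.mul_add, this, zero_add]
    rw [e]
    exact (norm_mul_le_of_le_one_left r₂.compl.norm_left_le _).trans
      (norm_mul_le_of_le_one_right r₁.compl.norm_right_le _)
  have h2 : ‖P₂ * (B * (1 - Q₁)) * Q₂‖ ≤ s + τ := by
    have e : P₂ * (B * (1 - Q₁)) * Q₂ = A * Q₂
        + P₂ * (U * (U.transpose * E * V) * V.transpose) * Q₂ := by
      have e1 : P₂ * (U * (U.transpose * E * V) * V.transpose) * Q₂ = P₂ * E * Q₂ := by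
        calc _ = P₂ * (U * U.transpose) * E * (V * V.transpose * Q₂) := by
              simp only [Matrix.mul_assoc]
          _ = _ := by rw [blockProj_mul_mul_transpose hU, mul_transpose_mul_blockProj hV]
      have e2 : P₂ * A * Q₂ = A * Q₂ := by
        rw [r₂.comm, Matrix.mul_assoc, r₂.right_idem]
      rw [e1, ← e2, ← Matrix.add_mul, ← Matrix.mul_add, ← hB, Matrix.mul_assoc, Matrix.mul_assoc,
        Matrix.sub_mul, hQ12, sub_zero, Matrix.one_mul, Matrix.mul_assoc]
    rw [e]
    refine (norm_add_le _ _).trans (add_le_add (norm_mul_blockProj_le hU hV hs0 hs) ?_)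
    exact (norm_mul_le_of_le_one_right r₂.norm_right_le _).trans
      ((norm_mul_le_of_le_one_left r₂.norm_left_le _).trans
        ((norm_mul_mul_transpose_le hU hV _).trans hτ))
  have h3 : ‖P₂ * (B * (1 - Q₁)) * (1 - Q₂)‖ ≤ ‖E‖ := by
    have e : P₂ * (B * (1 - Q₁)) * (1 - Q₂) = P₂ * (E * (1 - V * V.transpose)) := by
      have e1 : (1 - Q₁) * (1 - Q₂) = 1 - V * V.transpose := by
        rw [hQsum, Matrix.sub_mul, Matrix.one_mul, Matrix.mul_sub, Matrix.mul_one, hQ12]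
        abel
      rw [Matrix.mul_assoc, Matrix.mul_assoc, e1, hB, Matrix.add_mul, hAV, zero_add]
    rw [e]
    exact (norm_mul_le_of_le_one_left r₂.norm_left_le _).trans
      (norm_mul_le_of_le_one_right (norm_one_sub_mul_transpose_le hV) _)
  have h4 := norm_sq_le_add_of_projection_left r₂.left_symm r₂.left_idem (B * (1 - Q₁))
  have h5 := norm_sq_le_add_of_projection_right r₂.right_symm r₂.right_idem
    (P₂ * (B * (1 - Q₁)))
  have h1' := pow_le_pow_left₀ (norm_nonneg _) h1 2
  have h2' := pow_le_pow_left₀ (norm_nonneg _) h2 2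
  have h3' := pow_le_pow_left₀ (norm_nonneg _) h3 2
  linarith

end Blocks

/-! ### Singular values: Eckart–Young and perturbation bounds. -/

section SingularValues

variable {m n : ℕ}

theorem sv_nonneg (A : Matrix (Fin m) (Fin n) ℝ) (k : ℕ) : 0 ≤ sv A k :=
  LinearMap.singularValues_nonneg _ _

theorem sv_antitone (A : Matrix (Fin m) (Fin n) ℝ) : Antitone (sv A) := fun _ _ h =>
  LinearMap.singularValues_antitone _ (Nat.sub_le_sub_right h 1)

theorem rank_eq_finrank_range_toEuclideanLin (A : Matrix (Fin m) (Fin n) ℝ) :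
    A.rank = Module.finrank ℝ (Matrix.toEuclideanLin A).range := by
  rw [Matrix.rank_eq_finrank_range_toLin A (EuclideanSpace.basisFun (Fin m) ℝ).toBasis
    (EuclideanSpace.basisFun (Fin n) ℝ).toBasis, Matrix.toEuclideanLin_eq_toLin_orthonormal]

theorem sv_eq_zero_of_rank_lt {A : Matrix (Fin m) (Fin n) ℝ} {k : ℕ} (h : A.rank < k) :
    sv A k = 0 := by
  rw [sv, LinearMap.singularValues_eq_zero_iff_le_finrank_range,
    ← rank_eq_finrank_range_toEuclideanLin]
  omega

/-- The matrix with columns `u i`. -/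
def colMatrix {k : ℕ} (u : Fin k → EuclideanSpace ℝ (Fin m)) : Matrix (Fin m) (Fin k) ℝ :=
  Matrix.of fun a i => u i a

theorem colMatrix_transpose_mul_self {k : ℕ} {u : Fin k → EuclideanSpace ℝ (Fin m)}
    (hu : Orthonormal ℝ u) : (colMatrix u).transpose * colMatrix u = 1 := by
  ext i j
  have := orthonormal_iff_ite.mp hu i j
  rw [PiLp.inner_apply] at this
  rw [Matrix.one_apply, ← this]
  simp [Matrix.mul_apply, colMatrix, mul_comm]

theorem colMatrix_mul_diagonal_mul {k : ℕ} (u : Fin k → EuclideanSpace ℝ (Fin m))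
    (v : Fin k → EuclideanSpace ℝ (Fin n)) (d : Fin k → ℝ) :
    colMatrix u * Matrix.diagonal d * (colMatrix v).transpose
      = ∑ i, d i • Matrix.vecMulVec (u i).ofLp (v i).ofLp := by
  ext a b
  rw [Matrix.sum_apply, Matrix.mul_apply]
  refine Finset.sum_congr rfl fun i _ => ?_
  simp [colMatrix, Matrix.mul_diagonal, Matrix.vecMulVec_apply]
  ring

/-- A singular value decomposition in matrix form. -/
structure IsMatrixSVD (A : Matrix (Fin m) (Fin n) ℝ) (U : Matrix (Fin m) (Fin A.rank) ℝ)
    (V : Matrix (Fin n) (Fin A.rank) ℝ) : Prop where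
  left : U.transpose * U = 1
  right : V.transpose * V = 1
  eq : A = U * Matrix.diagonal (fun i : Fin A.rank => sv A ((i : ℕ) + 1)) * V.transpose

theorem IsSVD.isMatrixSVD {A : Matrix (Fin m) (Fin n) ℝ}
    {u : Fin A.rank → EuclideanSpace ℝ (Fin m)} {v : Fin A.rank → EuclideanSpace ℝ (Fin n)}
    (h : IsSVD A u v) : IsMatrixSVD A (colMatrix u) (colMatrix v) where
  left := colMatrix_transpose_mul_self h.orthonormal_left
  right := colMatrix_transpose_mul_self h.orthonormal_right
  eq := by rw [colMatrix_mul_diagonal_mul]; exact h.decomposition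

theorem IsSVD.sum_filter_eq_mul_blockProj {A : Matrix (Fin m) (Fin n) ℝ}
    {u : Fin A.rank → EuclideanSpace ℝ (Fin m)} {v : Fin A.rank → EuclideanSpace ℝ (Fin n)}
    (h : IsSVD A u v) (p : ℕ) :
    ∑ i ∈ Finset.univ.filter (fun i : Fin A.rank => (i : ℕ) < p),
      sv A ((i : ℕ) + 1) • Matrix.vecMulVec (u i).ofLp (v i).ofLp
      = A * blockProj (colMatrix v) (fun i => (i : ℕ) < p) := by
  have e := h.isMatrixSVD.eq
  have e2 : A * blockProj (colMatrix v) (fun i => (i : ℕ) < p) =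
    (colMatrix u * Matrix.diagonal (fun i : Fin A.rank => sv A ((i : ℕ) + 1)) * (colMatrix v).transpose) *
      blockProj (colMatrix v) (fun i => (i : ℕ) < p) := congrArg (· * _) e
  rw [e2, mul_blockProj h.isMatrixSVD.right, colMatrix_mul_diagonal_mul, Finset.sum_filter]
  refine Finset.sum_congr rfl fun i _ => ?_
  split_ifs <;> simp

theorem card_fin_lt_of_le {k q : ℕ} (h : q ≤ k) :
    Fintype.card {i : Fin k // (i : ℕ) < q} = q := by
  rw [Fintype.card_subtype, Fin.card_filter_val_lt, min_eq_right h]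

theorem card_fin_lt_le (k q : ℕ) : Fintype.card {i : Fin k // (i : ℕ) < q} ≤ q := by
  rw [Fintype.card_subtype, Fin.card_filter_val_lt]
  exact min_le_right _ _

theorem exists_isMatrixSVD (A : Matrix (Fin m) (Fin n) ℝ) : ∃ U V, IsMatrixSVD A U V := by
  obtain ⟨u, v, h⟩ := exists_isSVD A
  exact ⟨_, _, h.isMatrixSVD⟩

/-- The lower bound of the Eckart–Young theorem. -/
theorem sv_succ_le_norm_sub_of_rank_le (B : Matrix (Fin m) (Fin n) ℝ) {C : Matrix (Fin m) (Fin n) ℝ}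
    {p : ℕ} (hC : C.rank ≤ p) : sv B (p + 1) ≤ ‖B - C‖ := by
  rcases lt_or_ge p B.rank with hp | hp
  · obtain ⟨U, V, h⟩ := exists_isMatrixSVD B
    have := le_norm_svd_sub_of_rank_lt (S := fun i : Fin B.rank => (i : ℕ) < p + 1)
      (d := fun i : Fin B.rank => sv B ((i : ℕ) + 1)) h.left h.right (sv_nonneg B (p + 1))
      (fun i hi => sv_antitone B (Nat.succ_le_of_lt hi)) (C := C)
      (by rw [card_fin_lt_of_le hp]; omega)
    rwa [← h.eq] at this
  · rw [sv_eq_zero_of_rank_lt (Nat.lt_succ_of_le hp)]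
    exact norm_nonneg _

namespace IsMatrixSVD

variable {A B : Matrix (Fin m) (Fin n) ℝ} {U : Matrix (Fin m) (Fin A.rank) ℝ}
  {V : Matrix (Fin n) (Fin A.rank) ℝ} {U' : Matrix (Fin m) (Fin B.rank) ℝ}
  {V' : Matrix (Fin n) (Fin B.rank) ℝ}

theorem isReducing (h : IsMatrixSVD A U V) (S : Fin A.rank → Prop) [DecidablePred S] :
    IsReducing A (blockProj U S) (blockProj V S) := by
  have := isReducing_blockProj (S := S) (d := fun i : Fin A.rank => sv A ((i : ℕ) + 1)) h.left h.right
  rwa [← h.eq] at this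

theorem isBoundedBelow (h : IsMatrixSVD A U V) {S : Fin A.rank → Prop} [DecidablePred S] {c : ℝ}
    (hc : 0 < c) (hS : ∀ i, S i → c ≤ sv A ((i : ℕ) + 1)) :
    IsBoundedBelow A (blockProj U S) (blockProj V S) c := by
  have := isBoundedBelow_blockProj (S := S) (d := fun i : Fin A.rank => sv A ((i : ℕ) + 1)) h.left h.right hc hS
  rwa [← h.eq] at this

theorem norm_mul_blockProj_le (h : IsMatrixSVD A U V) {S : Fin A.rank → Prop} [DecidablePred S]
    {b : ℝ} (hb : 0 ≤ b) (hS : ∀ i, S i → sv A ((i : ℕ) + 1) ≤ b) : ‖A * blockProj V S‖ ≤ b := by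
  have := LowRankPerturbation.norm_mul_blockProj_le (S := S) (d := fun i : Fin A.rank => sv A ((i : ℕ) + 1))
    h.left h.right hb (fun i hi => by rw [abs_of_nonneg (sv_nonneg _ _)]; exact hS i hi)
  rwa [← h.eq] at this

theorem norm_mul_one_sub_blockProj_le (h : IsMatrixSVD A U V) {S : Fin A.rank → Prop}
    [DecidablePred S] {b : ℝ} (hb : 0 ≤ b) (hS : ∀ i, ¬ S i → sv A ((i : ℕ) + 1) ≤ b) :
    ‖A * (1 - blockProj V S)‖ ≤ b := by
  have := LowRankPerturbation.norm_mul_one_sub_blockProj_le (S := S)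
    (d := fun i : Fin A.rank => sv A ((i : ℕ) + 1)) h.left h.right hb
    (fun i hi => by rw [abs_of_nonneg (sv_nonneg _ _)]; exact hS i hi)
  rwa [← h.eq] at this

theorem mul_one_sub (h : IsMatrixSVD A U V) : A * (1 - V * V.transpose) = 0 := by
  have := h.norm_mul_one_sub_blockProj_le (S := fun _ => True) le_rfl (fun i hi => by simp at hi)
  rw [blockProj_true] at this
  exact norm_le_zero_iff.mp this

theorem one_sub_mul (h : IsMatrixSVD A U V) : (1 - U * U.transpose) * A = 0 := by
  have := (h.isReducing (fun _ => True)).compl.comm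
  rw [blockProj_true, blockProj_true, h.mul_one_sub] at this
  exact this

/-- The `p`-th singular value does not drop by more than the norm of the compression of the
perturbation to the singular subspaces. -/
theorem sv_le_sv_add (h : IsMatrixSVD A U V) {p : ℕ} (hp : 1 ≤ p) (hpr : p ≤ A.rank) :
    sv A p ≤ sv B p + ‖U.transpose * (B - A) * V‖ := by
  obtain ⟨U', V', h'⟩ := exists_isMatrixSVD B
  have hr : (B * blockProj V' (fun i => (i : ℕ) < p - 1)).rank
      < Fintype.card {i : Fin A.rank // (i : ℕ) < p} := by
    rw [card_fin_lt_of_le hpr]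
    exact (rank_mul_blockProj_le.trans (card_fin_lt_le _ _)).trans_lt (by omega)
  have := le_norm_sub_add_of_rank_lt (d := fun i : Fin A.rank => sv A ((i : ℕ) + 1)) h.left h.right
    (sv_nonneg A p) (fun i hi => sv_antitone A (Nat.succ_le_of_lt hi)) (B := B) hr
  rw [← h.eq] at this
  refine this.trans (add_le_add_left ?_ _)
  -- The competitor is `B` truncated to rank `p - 1`: its rank is too small for the `p` leading
  -- directions of `A`, and its distance from `B` is at most `σ_p(B)`.
  have h2 := h'.norm_mul_one_sub_blockProj_le (S := fun i => (i : ℕ) < p - 1) (sv_nonneg B p)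
    (fun i hi => sv_antitone B (by omega))
  rwa [Matrix.mul_sub, Matrix.mul_one] at h2

/-- Eckart–Young with the competitor `B Q₁`, where `Q₁` projects onto the leading right singular
vectors of `A` rather than of `B`. -/
theorem sv_succ_sq_le (h : IsMatrixSVD A U V) {p : ℕ} {τ : ℝ}
    (hτ : ‖U.transpose * (B - A) * V‖ ≤ τ) :
    sv B (p + 1) ^ 2 ≤ (sv A (p + 1) + τ) ^ 2 + 2 * ‖B - A‖ ^ 2 := by
  have h1 := sv_succ_le_norm_sub_of_rank_le B
    (rank_mul_blockProj_le.trans (card_fin_lt_le A.rank p) : (B * blockProj V _).rank ≤ p)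
  have h2 := norm_mul_one_sub_blockProj_sq_le (B := B) (S := fun i => (i : ℕ) < p)
    (d := fun i : Fin A.rank => sv A ((i : ℕ) + 1)) (τ := τ) h.left h.right (sv_nonneg A (p + 1))
    (fun i hi => by
      rw [abs_of_nonneg (sv_nonneg _ _)]
      exact sv_antitone A (by omega)) (by rw [← h.eq]; exact hτ)
  rw [← h.eq] at h2
  refine le_trans (pow_le_pow_left₀ (sv_nonneg _ _) h1 2) ?_
  rwa [Matrix.mul_sub, Matrix.mul_one] at h2

end IsMatrixSVD

end SingularValues

/-! ### The deterministic bound for the rank `p` approximation. -/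

section Deterministic

variable {m n : ℕ} {A B : Matrix (Fin m) (Fin n) ℝ}

/-- With `δ = σ - s`, having `s' > s + 2 δ / 3` would add at least `4 s δ / 3 + 4 δ² / 9` to `s²`,
while the hypotheses allow only small multiples of `s δ` and `δ²`. -/
theorem third_gap_le_of_sq_le {σ s s' τ N : ℝ} (hs : 0 ≤ s) (hδ : 0 < σ - s) (hτ0 : 0 ≤ τ)
    (hτ : τ ≤ (σ - s) / 96) (hN : N ^ 2 ≤ σ * (σ - s) / 18432)
    (hs' : s' ^ 2 ≤ (s + τ) ^ 2 + 2 * N ^ 2) : (σ - s) / 3 ≤ σ - s' := by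
  obtain ⟨δ, rfl⟩ : ∃ δ, σ = s + δ := ⟨σ - s, by ring⟩
  rw [add_sub_cancel_left] at *
  by_contra! h
  have h1 : s + 2 * δ / 3 < s' := by linarith
  have h2 : (s + 2 * δ / 3) ^ 2 < s' ^ 2 := pow_lt_pow_left₀ h1 (by positivity) two_ne_zero
  have h3 : (s + τ) ^ 2 ≤ (s + δ / 96) ^ 2 := pow_le_pow_left₀ (by positivity) (by linarith) 2
  nlinarith [mul_nonneg hs hδ.le, mul_pos hδ hδ]

theorem le_of_gap_mul_le {σ s σ' τ N w : ℝ} (hs : 0 ≤ s) (hδ : 0 < σ - s) (hτ0 : 0 ≤ τ)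
    (hτ : τ ≤ (σ - s) / 96) (hσ' : σ ≤ σ' + τ) (hw : (σ' - s) * w ≤ σ' * τ + N ^ 2) :
    w ≤ (2 * τ * σ + 2 * N ^ 2) / (σ - s) := by
  obtain ⟨δ, rfl⟩ : ∃ δ, σ = s + δ := ⟨σ - s, by ring⟩
  obtain ⟨g, rfl⟩ : ∃ g, σ' = s + g := ⟨σ' - s, by ring⟩
  rw [add_sub_cancel_left] at *
  have hg : δ / 2 ≤ g := by linarith
  have hg0 : 0 < g := by linarith
  rw [le_div_iff₀ hδ]
  -- Splitting `σ' τ = s τ + g τ` removes `σ'`, for which no upper bound is available.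
  have h1 : w - τ ≤ (s * τ + N ^ 2) / g := by
    rw [le_div_iff₀ hg0]
    linarith
  have h2 : (s * τ + N ^ 2) / g ≤ (s * τ + N ^ 2) / (δ / 2) :=
    div_le_div_of_nonneg_left (by positivity) (by positivity) hg
  have h3 : (w - τ) * δ ≤ (s * τ + N ^ 2) / (δ / 2) * δ :=
    mul_le_mul_of_nonneg_right (h1.trans h2) hδ.le
  have h4 : (s * τ + N ^ 2) / (δ / 2) * δ = 2 * (s * τ + N ^ 2) := by field_simp
  nlinarith [mul_nonneg hτ0 hδ.le]

/-- If the perturbation `B - A` is small compressed to the singular subspaces of `A`, the best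
rank `p` approximation of `A` is perturbed by no more than a multiple of `‖B - A‖` and terms of
second order. -/
theorem IsMatrixSVD.norm_mul_blockProj_sub_le {U : Matrix (Fin m) (Fin A.rank) ℝ}
    {V : Matrix (Fin n) (Fin A.rank) ℝ} {U' : Matrix (Fin m) (Fin B.rank) ℝ}
    {V' : Matrix (Fin n) (Fin B.rank) ℝ} (h : IsMatrixSVD A U V) (h' : IsMatrixSVD B U' V') {p : ℕ}
    (hp : 1 ≤ p) (hpr : p ≤ A.rank) (hgap : 0 < gap A p) {τ : ℝ}
    (hτ : ‖U.transpose * (B - A) * V‖ ≤ τ) (hτδ : τ ≤ gap A p / 96)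
    (hN : ‖B - A‖ ^ 2 ≤ sv A p * gap A p / 18432) :
    ‖B * blockProj V' (fun i => (i : ℕ) < p) - A * blockProj V (fun i => (i : ℕ) < p)‖
      ≤ 4 * ‖B - A‖ + (5 * τ * sv A p + 8 * ‖B - A‖ ^ 2) / gap A p := by
  have hτ0 : 0 ≤ τ := (norm_nonneg _).trans hτ
  have hs : 0 ≤ sv A (p + 1) := sv_nonneg _ _
  have hs' : 0 ≤ sv B (p + 1) := sv_nonneg _ _
  have hσ' : sv A p ≤ sv B p + τ := (h.sv_le_sv_add hp hpr).trans (by linarith)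
  have hsq := h.sv_succ_sq_le (p := p) hτ
  rw [gap] at *
  set σ := sv A p
  set s := sv A (p + 1)
  set σ' := sv B p
  set s' := sv B (p + 1)
  have hσ0 : 0 < σ := by linarith
  have hσ'0 : 0 < σ' := by linarith
  have hgap' : (σ - s) / 3 ≤ σ - s' := third_gap_le_of_sq_le hs hgap hτ0 hτδ hN hsq
  have hUA := h.one_sub_mul
  have hAV := h.mul_one_sub
  set P₁ := blockProj U (fun i => (i : ℕ) < p)
  set Q₁ := blockProj V (fun i => (i : ℕ) < p) with hQ₁
  set P₂ := blockProj U (fun i => ¬ (i : ℕ) < p)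
  set Q₂ := blockProj V (fun i => ¬ (i : ℕ) < p) with hQ₂
  set P := blockProj U' (fun i => (i : ℕ) < p) with hP
  set Q := blockProj V' (fun i => (i : ℕ) < p)
  -- The band of non-leading singular values of `B` still of order `σ`. Its cross term needs the
  -- small gap `σ - s'`, but its size makes the refined noise bound available; outside `T` the gap
  -- is at least `σ / 2`.
  let S : Fin B.rank → Prop := fun i => ¬ (i : ℕ) < p ∧ σ / 2 < sv B ((i : ℕ) + 1)
  let T : Fin B.rank → Prop := fun i => (i : ℕ) < p ∨ S i
  classical
  have hPT : blockProj U' T = P + blockProj U' S :=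
    blockProj_eq_add U' (fun i => Iff.rfl) (fun i hi hS => hS.1 hi)
  have hVV : V * V.transpose = Q₁ + Q₂ := by
    rw [← blockProj_true]
    exact blockProj_eq_add V (fun i => by tauto) (fun i h => by tauto)
  have r₁ : IsReducing A P₁ Q₁ := h.isReducing _
  have r₂ : IsReducing A P₂ Q₂ := h.isReducing _
  have r : IsReducing B P Q := h'.isReducing _
  have b₁ : IsBoundedBelow A P₁ Q₁ σ :=
    h.isBoundedBelow hσ0 fun i hi => sv_antitone A (Nat.succ_le_of_lt hi)
  have hneg : A - B = -(B - A) := (neg_sub _ _).symm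
  -- the part of `B` with small singular values
  have x₃ : ‖(1 - blockProj U' T) * A * Q₁‖ ≤ 2 * ‖B - A‖ := by
    have rT := (h'.isReducing T).compl
    have := (norm_cross_block_le r₁ rT b₁ (b := σ / 2) (f := ‖B - A‖) (by positivity)
      (by linarith) (h'.norm_mul_one_sub_blockProj_le (by positivity) fun i hi => by
        simp only [T, S, not_or, not_and, not_lt] at hi
        exact hi.2 hi.1)
      (by
        rw [hneg, Matrix.mul_neg, Matrix.neg_mul, norm_neg]
        exact (norm_mul_le_of_le_one_right r₁.norm_right_le _).trans
          (norm_mul_le_of_le_one_left rT.norm_left_le _))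
      (by
        rw [hneg, Matrix.mul_neg, Matrix.neg_mul, norm_neg]
        exact (norm_mul_le_of_le_one_right rT.norm_right_le _).trans
          (norm_mul_le_of_le_one_left r₁.norm_left_le _))).1
    refine le_of_mul_le_mul_left ?_ hσ0
    linarith
  -- the part of `B` with large singular values
  have x₂ : ‖blockProj U' S * A * Q₁‖ ≤ (3 * τ * σ + 6 * ‖B - A‖ ^ 2) / (σ - s) := by
    have rS := h'.isReducing S
    have bS := h'.isBoundedBelow (S := S) (c := σ / 2) (by positivity) fun i hi => hi.2.le
    obtain ⟨f1, f2⟩ := norm_block_mul_sub_mul_block_le (S := fun i => (i : ℕ) < p) h.left h.right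
      hUA hAV hτ rS bS (by positivity)
    have := (norm_cross_block_le r₁ rS b₁ hs' (by linarith)
      (h'.norm_mul_blockProj_le hs' fun i hi => sv_antitone B (by have := hi.1; omega))
      (f := τ + ‖B - A‖ ^ 2 / (σ / 2))
      (by rw [hneg, Matrix.mul_neg, Matrix.neg_mul, norm_neg]; exact f1)
      (by rw [hneg, Matrix.mul_neg, Matrix.neg_mul, norm_neg]; exact f2)).1
    have e : σ * (τ + ‖B - A‖ ^ 2 / (σ / 2)) = σ * τ + 2 * ‖B - A‖ ^ 2 := by field_simp
    rw [e] at this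
    rw [le_div_iff₀ hgap]
    have h1 := mul_le_mul_of_nonneg_right hgap' (norm_nonneg (blockProj U' S * A * Q₁))
    linarith
  -- Here the roles are exchanged: the leading block of `B` against the trailing block of `A`, with
  -- gap `σ' - s`.
  have w₂ : ‖P * B * Q₂‖ ≤ (2 * τ * σ + 2 * ‖B - A‖ ^ 2) / (σ - s) := by
    have b := h'.isBoundedBelow (S := fun i => (i : ℕ) < p) hσ'0
      fun i hi => sv_antitone B (Nat.succ_le_of_lt hi)
    obtain ⟨f1, f2⟩ := norm_block_mul_sub_mul_block_le (S := fun i => ¬ (i : ℕ) < p) h.left h.right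
      hUA hAV hτ r b hσ'0
    have := (norm_cross_block_le r r₂ b hs (by linarith)
      (h.norm_mul_blockProj_le hs fun i hi => sv_antitone A (by omega)) f2 f1).2
    have e : σ' * (τ + ‖B - A‖ ^ 2 / σ') = σ' * τ + ‖B - A‖ ^ 2 := by field_simp
    rw [e] at this
    exact le_of_gap_mul_le hs hgap hτ0 hτδ hσ' this
  have y₁ : ‖P * (B - A) * Q₁‖ ≤ ‖B - A‖ :=
    (norm_mul_le_of_le_one_right r₁.norm_right_le _).trans
      (norm_mul_le_of_le_one_left r.norm_left_le _)
  have y₃ : ‖P * ((B - A) * (1 - V * V.transpose))‖ ≤ ‖B - A‖ :=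
    (norm_mul_le_of_le_one_left r.norm_left_le _).trans
      (norm_mul_le_of_le_one_right (norm_one_sub_mul_transpose_le h.right) _)
  -- From `B Q = P B`: the right side of `P B` is split by `Q₁`, `Q₂` and `1 - V Vᵀ`, and `(1 - P) A
  -- Q₁` is split into the band `S` and the complement of `T`.
  have key : B * Q - A * Q₁ = P * (B - A) * Q₁ + P * B * Q₂
      + P * ((B - A) * (1 - V * V.transpose)) - blockProj U' S * A * Q₁
      - (1 - blockProj U' T) * A * Q₁ := by
    rw [Matrix.sub_mul B A, hAV, sub_zero, hVV, hPT, ← r.comm]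
    simp only [Matrix.mul_sub, Matrix.sub_mul, Matrix.mul_add, Matrix.add_mul, Matrix.mul_one,
      Matrix.one_mul, ← Matrix.mul_assoc]
    abel
  rw [key]
  have t1 := norm_sub_le (P * (B - A) * Q₁ + P * B * Q₂
      + P * ((B - A) * (1 - V * V.transpose)) - blockProj U' S * A * Q₁)
      ((1 - blockProj U' T) * A * Q₁)
  have t2 := norm_sub_le (P * (B - A) * Q₁ + P * B * Q₂
      + P * ((B - A) * (1 - V * V.transpose))) (blockProj U' S * A * Q₁)
  have t3 := norm_add₃_le (a := P * (B - A) * Q₁) (b := P * B * Q₂)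
    (c := P * ((B - A) * (1 - V * V.transpose)))
  have e : (5 * τ * σ + 8 * ‖B - A‖ ^ 2) / (σ - s) = (3 * τ * σ + 6 * ‖B - A‖ ^ 2) / (σ - s)
      + (2 * τ * σ + 2 * ‖B - A‖ ^ 2) / (σ - s) := by
    rw [← add_div]; ring
  rw [e]
  linarith

theorem IsBestRankApprox.norm_sub_le {B_p : Matrix (Fin m) (Fin n) ℝ} {p : ℕ}
    (hB : IsBestRankApprox B p B_p) : ‖B_p - B‖ ≤ sv B (p + 1) := by
  obtain ⟨u, v, h, rfl⟩ := hB
  rw [h.sum_filter_eq_mul_blockProj, ← norm_neg, neg_sub]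
  have := h.isMatrixSVD.norm_mul_one_sub_blockProj_le (S := fun i => (i : ℕ) < p)
    (sv_nonneg B (p + 1)) fun i hi => sv_antitone B (by omega)
  rwa [Matrix.mul_sub, Matrix.mul_one] at this

/-- Here `A_p = A`, and `A` is itself a competitor for `B` in Eckart–Young, so `‖B_p - B‖ ≤ ‖B -
A‖`. -/
theorem norm_sub_le_of_rank_le {A_p B_p : Matrix (Fin m) (Fin n) ℝ} {p : ℕ}
    (hA : IsBestRankApprox A p A_p) (hB : IsBestRankApprox B p B_p) (hr : A.rank ≤ p) :
    ‖B_p - A_p‖ ≤ 2 * ‖B - A‖ := by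
  have h1 := hA.norm_sub_le
  rw [sv_eq_zero_of_rank_lt (Nat.lt_succ_of_le hr)] at h1
  have h2 : A_p = A := sub_eq_zero.mp (norm_le_zero_iff.mp h1)
  have h3 := hB.norm_sub_le.trans (sv_succ_le_norm_sub_of_rank_le B hr)
  have h4 := norm_add_le (B_p - B) (B - A)
  rw [sub_add_sub_cancel] at h4
  rw [h2]
  linarith

/-- The rank `p` approximation bound under the condition `C0`, given that the entries of `E` in
the singular bases of `A` are at most `2 t₁`. -/
theorem norm_sub_le_of_C0 {E A_p B_p : Matrix (Fin m) (Fin n) ℝ} {p : ℕ} {t₁ : ℝ} (hp : 1 ≤ p)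
    (hpr : p < A.rank) (hgap : 0 < gap A p) (ht₁ : 0 < t₁)
    {u : Fin A.rank → EuclideanSpace ℝ (Fin m)} {v : Fin A.rank → EuclideanSpace ℝ (Fin n)}
    (h : IsSVD A u v)
    (hA_p : A_p = ∑ i ∈ Finset.univ.filter (fun i : Fin A.rank => (i : ℕ) < p),
      sv A ((i : ℕ) + 1) • Matrix.vecMulVec (u i).ofLp (v i).ofLp)
    (hE : ∀ i j, |((colMatrix u).transpose * E * colMatrix v) i j| ≤ 2 * t₁)
    (hC0 : C0 A E p t₁) (hB_p : IsBestRankApprox (A + E) p B_p) :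
    ‖B_p - A_p‖ ≤ 32 * (‖E‖ + A.rank * t₁ * sv A p / gap A p
      + A.rank ^ 2 * ‖E‖ ^ 2 / gap A p) := by
  obtain ⟨u', v', h', rfl⟩ := hB_p
  have hr2 : (2 : ℝ) ≤ A.rank := by exact_mod_cast (show 2 ≤ A.rank by omega)
  have hσ : 0 < sv A p := by
    have := sv_nonneg A (p + 1)
    rw [gap] at hgap
    linarith
  obtain ⟨⟨-, c2⟩, c3⟩ : ((p : ℝ) * epsOne A E p ≤ 1 / 96 ∧
      (A.rank : ℝ) ^ 2 * t₁ * epsTwo A p ≤ 1 / 96) ∧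
      Real.sqrt ((A.rank : ℝ) * eta A E p) ≤ 1 / 96 := by
    rw [← max_le_iff, ← max_le_iff]; exact hC0
  have hτ := l2_opNorm_le_card_mul (by positivity) hE
  rw [Fintype.card_fin] at hτ
  have c2' : (A.rank : ℝ) ^ 2 * t₁ ≤ gap A p / 96 := by
    rw [epsTwo, mul_one_div, div_le_iff₀ hgap] at c2
    linarith
  -- The factor `2` in the entry bound is absorbed by `r ≥ 2`.
  have hτδ : (A.rank : ℝ) * (2 * t₁) ≤ gap A p / 96 := by
    refine le_trans ?_ c2'
    nlinarith [mul_nonneg (mul_nonneg (Nat.cast_nonneg (α := ℝ) A.rank) ht₁.le)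
      (sub_nonneg.mpr hr2)]
  -- `18432 = 2 · 96²`, the factor `2` again coming from `r ≥ 2`.
  have hN : ‖E‖ ^ 2 ≤ sv A p * gap A p / 18432 := by
    rw [Real.sqrt_le_left (by norm_num), eta, mul_div_assoc', div_le_iff₀ (by positivity)] at c3
    nlinarith [mul_le_mul_of_nonneg_right hr2 (sq_nonneg ‖E‖)]
  have hE' : A + E - A = E := add_sub_cancel_left _ _
  have := h.isMatrixSVD.norm_mul_blockProj_sub_le h'.isMatrixSVD hp hpr.le hgap
    (τ := A.rank * (2 * t₁)) (by rw [hE']; exact hτ) hτδ (by rw [hE']; exact hN)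
  rw [hA_p, h.sum_filter_eq_mul_blockProj, h'.sum_filter_eq_mul_blockProj]
  refine this.trans ?_
  rw [hE', mul_add, mul_add, add_assoc]
  refine add_le_add (by linarith [norm_nonneg E]) ?_
  rw [← mul_add, ← add_div, mul_div_assoc']
  refine div_le_div_of_nonneg_right ?_ hgap.le
  have h1 : 0 ≤ (A.rank : ℝ) * t₁ * sv A p := by positivity
  have h2 : ‖E‖ ^ 2 ≤ (A.rank : ℝ) ^ 2 * ‖E‖ ^ 2 :=
    le_mul_of_one_le_left (sq_nonneg _) (by nlinarith)
  have h3 := sq_nonneg ‖E‖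
  linarith

end Deterministic

/-! ### Bernstein's inequality and the good event. -/

section Bernstein

variable {Ω : Type*} [MeasurableSpace Ω] {μ : Measure Ω} [IsProbabilityMeasure μ]

theorem integrable_of_abs_le {X : Ω → ℝ} (hX : Measurable X) {K : ℝ} (hb : ∀ᵐ ω ∂μ, |X ω| ≤ K) :
    Integrable X μ :=
  Integrable.of_bound hX.aestronglyMeasurable K hb

/-- The moment generating function of a bounded centred random variable. -/
theorem mgf_le_exp_of_abs_le_one {X : Ω → ℝ} (hX : Measurable X) {K σ l : ℝ}
    (hb : ∀ᵐ ω ∂μ, |X ω| ≤ K) (h0 : ∫ ω, X ω ∂μ = 0) (hv : variance X μ ≤ σ ^ 2)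
    (hl : |l| * K ≤ 1) : mgf X μ l ≤ Real.exp (l ^ 2 * σ ^ 2) := by
  have hi := integrable_of_abs_le hX hb
  have hi2 : Integrable (fun ω => X ω ^ 2) μ := by
    refine integrable_of_abs_le (hX.pow_const 2) (K := K ^ 2) ?_
    filter_upwards [hb] with ω hω
    rw [abs_pow]
    exact pow_le_pow_left₀ (abs_nonneg _) hω 2
  have hv2 : ∫ ω, X ω ^ 2 ∂μ ≤ σ ^ 2 := by
    rwa [variance_of_integral_eq_zero hX.aemeasurable h0] at hv
  -- `eˣ ≤ 1 + x + x²` for `|x| ≤ 1`; the linear term integrates to zero.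
  have hle : ∀ᵐ ω ∂μ, Real.exp (l * X ω) ≤ 1 + l * X ω + l ^ 2 * X ω ^ 2 := by
    filter_upwards [hb] with ω hω
    have h1 : |l * X ω| ≤ 1 := by
      rw [abs_mul]
      exact (mul_le_mul_of_nonneg_left hω (abs_nonneg l)).trans hl
    have := (abs_le.mp (Real.abs_exp_sub_one_sub_id_le h1)).2
    rw [mul_pow] at this
    linarith
  have hint : Integrable (fun ω => 1 + l * X ω + l ^ 2 * X ω ^ 2) μ :=
    ((integrable_const 1).add (hi.const_mul l)).add (hi2.const_mul (l ^ 2))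
  calc mgf X μ l = ∫ ω, Real.exp (l * X ω) ∂μ := rfl
    _ ≤ ∫ ω, (1 + l * X ω + l ^ 2 * X ω ^ 2) ∂μ :=
        integral_mono_of_nonneg (ae_of_all _ fun _ => (Real.exp_pos _).le) hint hle
    _ = 1 + l ^ 2 * ∫ ω, X ω ^ 2 ∂μ := by
        have e : ∫ ω, (1 + l * X ω + l ^ 2 * X ω ^ 2) ∂μ
            = ∫ ω, (1 + l * X ω) ∂μ + ∫ ω, l ^ 2 * X ω ^ 2 ∂μ :=
          integral_add ((integrable_const 1).add (hi.const_mul l)) (hi2.const_mul (l ^ 2))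
        rw [e, integral_add (integrable_const 1) (hi.const_mul l), integral_const_mul,
          integral_const_mul, h0]
        simp
    _ ≤ 1 + l ^ 2 * σ ^ 2 := by
        have := mul_le_mul_of_nonneg_left hv2 (sq_nonneg l)
        linarith
    _ ≤ _ := by linarith [Real.add_one_le_exp (l ^ 2 * σ ^ 2)]

/-- Bernstein's inequality for a weighted sum with square summable weights. -/
theorem measureReal_weighted_sum_ge_le {ι : Type*} [Fintype ι] {X : ι → Ω → ℝ}
    (hX : ∀ i, Measurable (X i)) (hind : iIndepFun X μ) {K σ : ℝ}
    (hb : ∀ᵐ ω ∂μ, ∀ i, |X i ω| ≤ K) (h0 : ∀ i, ∫ ω, X i ω ∂μ = 0)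
    (hv : ∀ i, variance (X i) μ ≤ σ ^ 2) (hK : 0 ≤ K) {w : ι → ℝ} (hw : ∑ i, w i ^ 2 ≤ 1)
    {t : ℝ} (ht : 0 < t) (hpos : 0 < 2 * σ ^ 2 + K * t) :
    μ.real {ω | t ≤ ∑ i, w i * X i ω} ≤ Real.exp (-(t ^ 2 / 2) / (2 * σ ^ 2 + K * t)) := by
  -- This parameter meets `l K ≤ 1`, and `l² (2 σ² + K t) = l t` makes the Chernoff exponent `-l t +
  -- l² σ²` at most `-l t / 2`.
  set l := t / (2 * σ ^ 2 + K * t) with hl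
  have hl0 : 0 < l := by positivity
  have hw1 : ∀ i, |w i| ≤ 1 := by
    intro i
    rw [← sq_le_one_iff_abs_le_one]
    exact (Finset.single_le_sum (f := fun i => w i ^ 2) (fun i _ => sq_nonneg _)
      (Finset.mem_univ i)).trans hw
  have hlK : l * K ≤ 1 := by
    rw [hl, div_mul_eq_mul_div, div_le_one hpos]
    nlinarith [sq_nonneg σ]
  have hind' : iIndepFun (fun i ω => w i * X i ω) μ :=
    hind.comp (fun i x => w i * x) fun i => measurable_const_mul (w i)
  have hsum : (fun ω => ∑ i, w i * X i ω) = ∑ i, fun ω => w i * X i ω := by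
    ext ω; simp
  have hmgf : mgf (fun ω => ∑ i, w i * X i ω) μ l ≤ Real.exp (l ^ 2 * σ ^ 2) := by
    rw [hsum, hind'.mgf_sum (fun i => (hX i).const_mul (w i))]
    calc _ ≤ ∏ i, Real.exp ((l * w i) ^ 2 * σ ^ 2) := by
          refine Finset.prod_le_prod (fun i _ => mgf_nonneg) fun i _ => ?_
          have e : mgf (fun ω => w i * X i ω) μ l = mgf (X i) μ (l * w i) := by
            simp only [mgf, mul_assoc]
          rw [e]
          refine mgf_le_exp_of_abs_le_one (hX i) (hb.mono fun ω h => h i) (h0 i) (hv i) ?_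
          rw [abs_mul, abs_of_pos hl0]
          refine le_trans (mul_le_mul_of_nonneg_right ?_ hK) hlK
          exact mul_le_of_le_one_right hl0.le (hw1 i)
      _ = Real.exp (l ^ 2 * σ ^ 2 * ∑ i, w i ^ 2) := by
          rw [← Real.exp_sum, Finset.mul_sum]
          congr 1
          exact Finset.sum_congr rfl fun i _ => by ring
      _ ≤ _ := Real.exp_le_exp.mpr (mul_le_of_le_one_right (by positivity) hw)
  have hmeas : Measurable fun ω => ∑ i, w i * X i ω :=
    Finset.measurable_sum _ fun i _ => (hX i).const_mul (w i)
  have hint : Integrable (fun ω => Real.exp (l * ∑ i, w i * X i ω)) μ := by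
    refine integrable_of_abs_le (hmeas.const_mul l).exp (K := Real.exp (l * ∑ _i : ι, K)) ?_
    filter_upwards [hb] with ω hω
    rw [Real.abs_exp]
    refine Real.exp_le_exp.mpr (mul_le_mul_of_nonneg_left (Finset.sum_le_sum fun i _ => ?_) hl0.le)
    calc w i * X i ω ≤ |w i| * |X i ω| := by rw [← abs_mul]; exact le_abs_self _
      _ ≤ 1 * |X i ω| := mul_le_mul_of_nonneg_right (hw1 i) (abs_nonneg _)
      _ ≤ K := by rw [one_mul]; exact hω i
  refine (measure_ge_le_exp_mul_mgf t hl0.le hint).trans ?_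
  calc _ ≤ Real.exp (-l * t) * Real.exp (l ^ 2 * σ ^ 2) :=
        mul_le_mul_of_nonneg_left hmgf (Real.exp_pos _).le
    _ = Real.exp (-l * t + l ^ 2 * σ ^ 2) := (Real.exp_add _ _).symm
    _ ≤ _ := by
        refine Real.exp_le_exp.mpr ?_
        have h1 : l * (2 * σ ^ 2 + K * t) = t := div_mul_cancel₀ _ hpos.ne'
        have h2 : -(t ^ 2 / 2) / (2 * σ ^ 2 + K * t) = -(l * t) / 2 := by
          rw [hl]; ring
        have h3 : 0 ≤ l * (l * (K * t)) := by positivity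
        rw [h2]
        have h4 : l * (l * (2 * σ ^ 2 + K * t)) = l * t := by rw [h1]
        linarith

/-- Bernstein's inequality for the absolute value of a bilinear form `xᵀ E y` in a bounded random
matrix. -/
theorem IsBoundedRandomMatrix.measureReal_abs_bilin_gt_le {m n : ℕ}
    {E : Ω → Matrix (Fin m) (Fin n) ℝ} {K σ : ℝ} (hE : IsBoundedRandomMatrix μ E K σ) (hK : 0 ≤ K)
    {x : EuclideanSpace ℝ (Fin m)} {y : EuclideanSpace ℝ (Fin n)} (hx : ‖x‖ = 1) (hy : ‖y‖ = 1)
    {t : ℝ} (ht : 0 < t) (hpos : 0 < 2 * σ ^ 2 + K * t) :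
    μ.real {ω | t < |∑ i, ∑ j, x i * y j * E ω i j|}
      ≤ 2 * Real.exp (-(t ^ 2 / 2) / (2 * σ ^ 2 + K * t)) := by
  have hw : ∑ ij : Fin m × Fin n, (x ij.1 * y ij.2) ^ 2 = 1 := by
    have h1 := EuclideanSpace.norm_sq_eq x
    have h2 := EuclideanSpace.norm_sq_eq y
    simp only [hx, hy, one_pow, Real.norm_eq_abs, sq_abs] at h1 h2
    rw [Fintype.sum_prod_type]
    simp only [mul_pow]
    rw [← Finset.sum_mul_sum, ← h1, ← h2, one_mul]
  have hb : ∀ᵐ ω ∂μ, ∀ ij : Fin m × Fin n, |E ω ij.1 ij.2| ≤ K :=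
    hE.bounded.mono fun ω h ij => h _ _
  have hplus := measureReal_weighted_sum_ge_le (fun ij : Fin m × Fin n => hE.measurable_entry _ _)
    hE.indep hb (fun _ => hE.mean_zero _ _) (fun _ => hE.variance_le _ _) hK hw.le ht hpos
  have hminus := measureReal_weighted_sum_ge_le
    (fun ij : Fin m × Fin n => hE.measurable_entry _ _)
    hE.indep hb (fun _ => hE.mean_zero _ _) (fun _ => hE.variance_le _ _) hK
    (w := fun ij => -(x ij.1 * y ij.2)) (by simpa using hw.le) ht hpos
  have hsub : {ω | t < |∑ i, ∑ j, x i * y j * E ω i j|}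
      ⊆ {ω | t ≤ ∑ ij : Fin m × Fin n, x ij.1 * y ij.2 * E ω ij.1 ij.2} ∪
        {ω | t ≤ ∑ ij : Fin m × Fin n, -(x ij.1 * y ij.2) * E ω ij.1 ij.2} := by
    intro ω hω
    simp only [Set.mem_ofPred_eq, Set.mem_union, Fintype.sum_prod_type, neg_mul,
      Finset.sum_neg_distrib] at hω ⊢
    rcases lt_abs.mp hω with h | h
    · exact Or.inl h.le
    · exact Or.inr h.le
  refine (measureReal_mono hsub).trans ((measureReal_union_le _ _).trans ?_)
  linarith

/-- In given orthonormal systems all entries of a bounded random matrix are at most `2 t` outside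
of an event of small probability. -/
theorem IsBoundedRandomMatrix.one_sub_le_measureReal_forall_abs_le {m n r : ℕ}
    {E : Ω → Matrix (Fin m) (Fin n) ℝ} {K σ : ℝ} (hE : IsBoundedRandomMatrix μ E K σ) (hr : 2 ≤ r)
    {u : Fin r → EuclideanSpace ℝ (Fin m)} {v : Fin r → EuclideanSpace ℝ (Fin n)}
    (hu : Orthonormal ℝ u) (hv : Orthonormal ℝ v) {t : ℝ} (ht : 0 < t) :
    MeasurableSet {ω | ∀ i j, |((colMatrix u).transpose * E ω * colMatrix v) i j| ≤ 2 * t} ∧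
      1 - (r : ℝ) ^ 2 * Real.exp (-(t ^ 2 / 2) / (2 * σ ^ 2 + K * t))
        ≤ μ.real {ω | ∀ i j, |((colMatrix u).transpose * E ω * colMatrix v) i j| ≤ 2 * t} := by
  have hform : ∀ ω i j, ((colMatrix u).transpose * E ω * colMatrix v) i j
      = ∑ a, ∑ b, u i a * v j b * E ω a b := by
    intro ω i j
    simp only [Matrix.mul_apply, Matrix.transpose_apply, colMatrix, Matrix.of_apply,
      Finset.sum_mul]
    rw [Finset.sum_comm]
    exact Finset.sum_congr rfl fun a _ => Finset.sum_congr rfl fun b _ => by ring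
  simp only [hform]
  set f : Fin r → Fin r → Ω → ℝ := fun i j ω => ∑ a, ∑ b, u i a * v j b * E ω a b with hf
  have hfm : ∀ i j, Measurable (f i j) := fun i j =>
    Finset.measurable_sum _ fun a _ => Finset.measurable_sum _ fun b _ =>
      (hE.measurable_entry a b).const_mul _
  have hG : MeasurableSet {ω | ∀ i j, |f i j ω| ≤ 2 * t} := by
    simp only [Set.ofPred_forall]
    exact MeasurableSet.iInter fun i => MeasurableSet.iInter fun j =>
      measurableSet_le (hfm i j).abs measurable_const
  refine ⟨hG, ?_⟩
  set q := Real.exp (-(t ^ 2 / 2) / (2 * σ ^ 2 + K * t)) with hq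
  have hr' : (2 : ℝ) ≤ r := by exact_mod_cast hr
  have hr4 : (4 : ℝ) ≤ (r : ℝ) ^ 2 := by nlinarith
  -- If `q ≥ 1/4`, then `r² q ≥ 1` and the claim is empty. Otherwise `2 q² ≤ q`, which absorbs the
  -- factor `2` of the two-sided tail.
  rcases le_or_gt (1 / 4) q with hq4 | hq4
  · have : 1 ≤ (r : ℝ) ^ 2 * q := by nlinarith
    linarith [measureReal_nonneg (μ := μ) (s := {ω | ∀ i j, |f i j ω| ≤ 2 * t})]
  -- The sign of `K` follows from the almost sure bound on an entry; unit vectors exist, so the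
  -- matrix has one.
  have hK : 0 ≤ K := by
    have i : Fin r := ⟨0, by omega⟩
    have hm : Nonempty (Fin m) := by
      by_contra h
      have := not_nonempty_iff.mp h
      have h1 := hu.1 i
      rw [Subsingleton.elim (u i) 0, norm_zero] at h1
      exact zero_ne_one h1
    have hn : Nonempty (Fin n) := by
      by_contra h
      have := not_nonempty_iff.mp h
      have h1 := hv.1 i
      rw [Subsingleton.elim (v i) 0, norm_zero] at h1
      exact zero_ne_one h1
    obtain ⟨ω, hω⟩ := hE.bounded.exists
    exact (abs_nonneg _).trans (hω hm.some hn.some)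
  -- In the degenerate case division by zero gives `q = 1`, excluded by `q < 1/4`.
  have hpos : 0 < 2 * σ ^ 2 + K * t := by
    refine lt_of_le_of_ne (by positivity) fun h => ?_
    rw [hq, ← h, div_zero, Real.exp_zero] at hq4
    norm_num at hq4
  have hbound : ∀ i j, μ.real {ω | 2 * t < |f i j ω|} ≤ q := by
    intro i j
    have hKt : 0 ≤ K * t := by positivity
    have h1 := hE.measureReal_abs_bilin_gt_le hK (hu.1 i) (hv.1 j) (t := 2 * t) (by positivity)
      (by linarith)
    refine h1.trans ?_
    -- Doubling `t` multiplies the numerator by four and the denominator by at most two, so the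
    -- exponent at least doubles. This is why the entries are compared with `2 t`.
    have h2 : Real.exp (-((2 * t) ^ 2 / 2) / (2 * σ ^ 2 + K * (2 * t))) ≤ q ^ 2 := by
      rw [sq q, hq, ← Real.exp_add]
      refine Real.exp_le_exp.mpr ?_
      rw [← add_div, neg_div, ← neg_add, neg_div, neg_le_neg_iff, div_le_div_iff₀ hpos (by linarith)]
      nlinarith [mul_nonneg (sq_nonneg t) (sq_nonneg σ), mul_nonneg (sq_nonneg t) hKt]
    have hq0 : 0 < q := Real.exp_pos _
    nlinarith
  have hcompl : μ.real {ω | ∀ i j, |f i j ω| ≤ 2 * t}ᶜ ≤ (r : ℝ) ^ 2 * q := by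
    have e : {ω | ∀ i j, |f i j ω| ≤ 2 * t}ᶜ
        = ⋃ ij : Fin r × Fin r, {ω | 2 * t < |f ij.1 ij.2 ω|} := by
      ext ω
      simp
    rw [e]
    refine (measureReal_iUnion_fintype_le _).trans ?_
    refine (Finset.sum_le_sum fun ij _ => hbound ij.1 ij.2).trans (le_of_eq ?_)
    rw [Finset.sum_const, Finset.card_univ, Fintype.card_prod, Fintype.card_fin, nsmul_eq_mul]
    push_cast
    ring
  rw [probReal_compl_eq_one_sub hG] at hcompl
  linarith

end Bernstein

end LowRankPerturbation

/-! ### The main theorem. -/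

open LowRankPerturbation in
theorem mainTheorem8 {Ω : Type*} [MeasurableSpace Ω] (μ : Measure Ω) [IsProbabilityMeasure μ]
    {m n : ℕ} (hmn : m ≤ n) (A : Matrix (Fin m) (Fin n) ℝ) (r : ℕ) (hr : A.rank = r)
    (p : ℕ) (hp : 1 ≤ p) (hpr : p ≤ r) (hgap : 0 < gap A p)
    (E : Ω → Matrix (Fin m) (Fin n) ℝ) (K σ : ℝ) (hE : IsBoundedRandomMatrix μ E K σ)
    (A_p : Matrix (Fin m) (Fin n) ℝ) (hA_p : IsBestRankApprox A p A_p)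
    (t₁ : ℝ) (ht₁ : 0 < t₁) :
    ∃ G : Set Ω, MeasurableSet G ∧
      1 - (r : ℝ) ^ 2 * Real.exp (-(t₁ ^ 2 / 2) / (2 * σ ^ 2 + K * t₁)) ≤ μ.real G ∧
      ∀ ω ∈ G, C0 A (E ω) p t₁ →
        ∀ At_p : Matrix (Fin m) (Fin n) ℝ, IsBestRankApprox (A + E ω) p At_p →
          ‖At_p - A_p‖ ≤ 32 * sv A p *
            (epsOne A (E ω) p + r * t₁ * epsTwo A p
              + r ^ 2 * ‖E ω‖ ^ 2 / (sv A p * gap A p)) ∧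
          32 * sv A p *
            (epsOne A (E ω) p + r * t₁ * epsTwo A p
              + r ^ 2 * ‖E ω‖ ^ 2 / (sv A p * gap A p))
            = 32 * (‖E ω‖ + r * t₁ * sv A p / gap A p + r ^ 2 * ‖E ω‖ ^ 2 / gap A p) := by
  subst hr
  have hσ : sv A p ≠ 0 := by
    have := sv_nonneg A (p + 1)
    rw [gap] at hgap
    linarith
  have hid : ∀ x : ℝ, 32 * sv A p * (x / sv A p + A.rank * t₁ * (1 / gap A p)
      + (A.rank : ℝ) ^ 2 * x ^ 2 / (sv A p * gap A p))
      = 32 * (x + A.rank * t₁ * sv A p / gap A p + (A.rank : ℝ) ^ 2 * x ^ 2 / gap A p) := by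
    intro x
    have hg := hgap.ne'
    field_simp
  simp only [epsOne, epsTwo, hid, and_true]
  -- For `p = r` the estimate holds surely. For `p < r` one has `r ≥ 2`, which the constants of both
  -- the probabilistic and the deterministic part need.
  rcases hpr.eq_or_lt with hpr | hpr
  · refine ⟨Set.univ, MeasurableSet.univ, ?_, fun ω _ _ At_p hAt_p => ?_⟩
    · rw [probReal_univ]
      have : 0 ≤ (A.rank : ℝ) ^ 2 * Real.exp (-(t₁ ^ 2 / 2) / (2 * σ ^ 2 + K * t₁)) := by
        positivity
      linarith
    · have h := norm_sub_le_of_rank_le hA_p hAt_p hpr.ge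
      rw [add_sub_cancel_left] at h
      have h1 : 0 ≤ (A.rank : ℝ) * t₁ * sv A p / gap A p := by
        have := sv_nonneg A p
        positivity
      have h2 : 0 ≤ (A.rank : ℝ) ^ 2 * ‖E ω‖ ^ 2 / gap A p := by positivity
      linarith [norm_nonneg (E ω)]
  -- The event is built from the singular vectors of `A` that define `A_p`; they do not depend on
  -- `E`, and the event serves every choice of `At_p`.
  · obtain ⟨u, v, h, hA_p⟩ := hA_p
    obtain ⟨hG, hprob⟩ := hE.one_sub_le_measureReal_forall_abs_le
      (show 2 ≤ A.rank by omega) h.orthonormal_left h.orthonormal_right ht₁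
    exact ⟨_, hG, hprob, fun ω hω hC0 At_p hAt_p =>
      norm_sub_le_of_C0 hp hpr hgap ht₁ h hA_p hω hC0 hAt_p⟩
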